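/- Let $n\ge 2$, $0<a<1$ and $A=\{x\in\mathbb R^n : a<|x|<1\}$. Let $\Gamma$ be the fundamental solution of $-\Delta$ in $\mathbb R^n$, that is, $\Gamma(x)=\frac{1}{(n-2)\,\omega_{n-1}|x|^{n-2}}$ if $n\ge 3$ (where $\omega_{n-1}$ is the area of the unit sphere of $\mathbb R^n$) and $\Gamma(x)=-\frac1{2\pi}\log|x|$ if $n=2$. Let $G_A$ be the Dirichlet Green function of $-\Delta$ in $A$: for every $y\in A$, the function $G_A(\cdot,y)$ is locally integrable in $A$ and continuous on $\overline A\setminus\{y\}$, it satisfies $-\Delta_x G_A(\cdot,y)=\delta_y$ in $A$ in the sense of distributions, and $G_A(\cdot,y)=0$ on $\partial A$. Such a function exists. Write $H_A(x,y)=G_A(x,y)-\Gamma(x-y)$ for $x\neq y$, and let $R_A(y)=\lim_{x\to y}H_A(x,y)$, $y\in A$, be the Robin function of $A$; this limit exists for every $y\in A$. Then $R_A$ is radial: there is a function $R$, of class $C^2$ on $(a,1)$, with $R_A(x)=R(|x|)$ for all $x\in A$. The function $R$ has exactly one critical point $r_0$ in $(a,1)$, and it is nondegenerate: $R''(r_0)<0$.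 Moreover $r\mapsto rR'(r)$ is strictly decreasing on $(a,1)$, with $rR'(r)\to+\infty$ as $r\to a^+$ and $rR'(r)\to-\infty$ as $r\to 1^-$. -/

import Mathlib

open Filter Topology MeasureTheory
open scoped Laplacian ContDiff

/-- The annulus `{x ∈ ℝⁿ : a < |x| < 1}`. -/
def annulus (n : ℕ) (a : ℝ) : Set (EuclideanSpace ℝ (Fin n)) :=
  {x | a < ‖x‖ ∧ ‖x‖ < 1}

/-- The surface area `ω_{n-1}` of the unit sphere of `ℝⁿ`. -/
noncomputable def sphereArea (n : ℕ) : ℝ :=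
  (volume : Measure (EuclideanSpace ℝ (Fin n))).toSphere.real Set.univ

/-- The fundamental solution of `-Δ` on `ℝⁿ`, for `n ≥ 2` and away from the origin:
`1 / ((n-2) ω_{n-1} |x|^{n-2})` if `n ≥ 3`, and `-(1 / 2π) log |x|` if `n = 2`. -/
noncomputable def newtonKernel (n : ℕ) (x : EuclideanSpace ℝ (Fin n)) : ℝ :=
  if n = 2 then -(1 / (2 * Real.pi)) * Real.log ‖x‖
  else 1 / (((n : ℝ) - 2) * sphereArea n * ‖x‖ ^ (n - 2))

/-- `G` is the Green function of `-Δ` in `Ω` with Dirichlet boundary conditions: for every pole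
`y ∈ Ω`, `-Δ_x G(x, y) = δ_y(x)` holds in `Ω` in the sense of distributions, and `G(·, y)` vanishes
on `∂Ω`, where it is attained continuously. The values `G(y, y)` are irrelevant. -/
structure IsGreenFunction {n : ℕ} (Ω : Set (EuclideanSpace ℝ (Fin n)))
    (G : EuclideanSpace ℝ (Fin n) → EuclideanSpace ℝ (Fin n) → ℝ) : Prop where
  /-- `G(·, y)` is a locally integrable function, hence a distribution, on `Ω`. -/
  locallyIntegrableOn : ∀ y ∈ Ω, LocallyIntegrableOn (fun x => G x y) Ω volume
  /-- `-Δ_x G(·, y) = δ_y` in `Ω`, tested against every `φ ∈ C_c^∞(Ω)`. -/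
  neg_laplacian_eq_dirac : ∀ y ∈ Ω, ∀ φ : EuclideanSpace ℝ (Fin n) → ℝ,
    ContDiff ℝ ∞ φ → HasCompactSupport φ → tsupport φ ⊆ Ω →
      ∫ x in Ω, G x y * (-(Δ φ) x) = φ y
  /-- `G(·, y)` is continuous up to the boundary, away from the pole. -/
  continuousOn : ∀ y ∈ Ω, ContinuousOn (fun x => G x y) (closure Ω \ {y})
  /-- `G(·, y) = 0` on `∂Ω`. -/
  eq_zero_of_mem_frontier : ∀ y ∈ Ω, ∀ x ∈ frontier Ω, G x y = 0

/-- The Green function of `Ω` (if there is one). -/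
noncomputable def greenFunction {n : ℕ} (Ω : Set (EuclideanSpace ℝ (Fin n))) :
    EuclideanSpace ℝ (Fin n) → EuclideanSpace ℝ (Fin n) → ℝ :=
  Classical.epsilon (IsGreenFunction Ω)

/-- The regular part `H(x, y) = G(x, y) - Γ(x - y)` of the Green function, for `x ≠ y`. -/
noncomputable def regularPart {n : ℕ} (Ω : Set (EuclideanSpace ℝ (Fin n)))
    (x y : EuclideanSpace ℝ (Fin n)) : ℝ :=
  greenFunction Ω x y - newtonKernel n (x - y)

/-- The Robin function `R(y) = H(y, y)`, where `H` is extended to the diagonal by continuity: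
`R(y) = lim_{x → y} (G(x, y) - Γ(x - y))`. -/
noncomputable def robinFunction {n : ℕ} (Ω : Set (EuclideanSpace ℝ (Fin n)))
    (y : EuclideanSpace ℝ (Fin n)) : ℝ :=
  limUnder (𝓝[≠] y) (fun x => regularPart Ω x y)

/-! The proof makes everything explicit. Repeated reflection of the pole in the two boundary spheres
gives a Green function as a series of image charges: with q = a^(2(k+1)), each reflection step
contributes charges at qy and y/q and opposite charges at qy/|y|² and y/(q|y|²), all outside the
annulus, weighted by a^((n-2)(k+1)). The charge at y/|y|² stands apart, and in dimension two a
multiple of log|x| corrects the inner boundary value. On |x| = 1 the charges cancel in pairs; on |x|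
= a the series telescopes. This is `isGreenFunction_annulusGreen`; its analytic input is -ΔΓ = δ
(`integral_newtonKernel_sub_mul_laplacian`).

The Green function of the statement is an arbitrary choice, so uniqueness off the diagonal is
needed: the difference of two candidates is harmonic as a distribution, even across the pole, and
vanishes on the boundary. Mollifying it and applying the maximum principle forces it to vanish
(`eq_zero_of_distributional_harmonic`).

Hence the Robin function is the image series on the diagonal, a function `robinProfile` of r = |y|.
With n = m + 2 and ω the area of the unit sphere, ω r R'(r) is the series `robinFlux`. Each of its
terms decreases (`diagFluxDeriv_neg`), as do the two remaining contributions, and the one from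
y/|y|² does so strictly. The nearest inner image, q = a², drives the flux to +∞ at r = a; the image
y/|y|² drives it to -∞ at r = 1. The flux therefore has one zero r₀, where R'' has the sign of its
derivative. -/

/-! ### Calculus of the radial kernel. -/

/-- The profile of the fundamental solution: `newtonKernel n x = radialKernel n ‖x‖`. -/
noncomputable def radialKernel (n : ℕ) (s : ℝ) : ℝ :=
  if n = 2 then -(1 / (2 * Real.pi)) * Real.log s
  else 1 / (((n : ℝ) - 2) * sphereArea n * s ^ (n - 2))

lemma newtonKernel_eq (n : ℕ) (x : EuclideanSpace ℝ (Fin n)) :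
    newtonKernel n x = radialKernel n ‖x‖ := rfl

lemma sphereArea_pos {n : ℕ} (hn : 2 ≤ n) : 0 < sphereArea n := by
  rw [sphereArea, Measure.toSphere_real_apply_univ]
  have : 0 < Module.finrank ℝ (EuclideanSpace ℝ (Fin n)) := by simp; omega
  have h2 : 0 < (volume : Measure (EuclideanSpace ℝ (Fin n))).real (Metric.ball 0 1) :=
    ENNReal.toReal_pos (Metric.measure_ball_pos volume _ one_pos).ne' measure_ball_lt_top.ne
  positivity

lemma sphereArea_two : sphereArea 2 = 2 * Real.pi := by
  rw [sphereArea, Measure.toSphere_real_apply_univ]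
  simp [measureReal_def, Real.pi_pos.le]

/-- This normalization gives total flux -1 through every sphere about the origin. It unifies the
logarithmic and power cases, because ω₁ = 2π. -/
lemma hasDerivAt_radialKernel {n : ℕ} (hn : 2 ≤ n) {s : ℝ} (hs : 0 < s) :
    HasDerivAt (radialKernel n) (-(sphereArea n * s ^ (n - 1))⁻¹) s := by
  have hω := sphereArea_pos hn
  rcases eq_or_lt_of_le hn with rfl | h3
  · have h : HasDerivAt (fun s => -(1 / (2 * Real.pi)) * Real.log s)
        (-(1 / (2 * Real.pi)) * s⁻¹) s := (Real.hasDerivAt_log hs.ne').const_mul _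
    have e : radialKernel 2 = fun s => -(1 / (2 * Real.pi)) * Real.log s := by
      ext s; simp [radialKernel]
    rw [e, sphereArea_two]
    refine h.congr_deriv ?_
    simp
    ring
  · obtain ⟨m, rfl⟩ : ∃ m, n = m + 3 := ⟨n - 3, by omega⟩
    have e : radialKernel (m + 3) =
        fun s => (((m : ℝ) + 1) * sphereArea (m + 3))⁻¹ * (s ^ (m + 1))⁻¹ := by
      ext s
      have : ((m + 3 : ℕ) : ℝ) - 2 = m + 1 := by push_cast; ring
      simp only [radialKernel, this]
      rw [if_neg (by omega), show m + 3 - 2 = m + 1 by omega, one_div, mul_inv]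
    rw [e]
    have h := ((hasDerivAt_pow (m + 1) s).inv (pow_ne_zero _ hs.ne')).const_mul
      ((((m : ℝ) + 1) * sphereArea (m + 3))⁻¹)
    have : (m : ℝ) + 1 ≠ 0 := by positivity
    refine h.congr_deriv ?_
    rw [show m + 3 - 1 = m + 2 by omega]
    simp only [Nat.add_sub_cancel]
    push_cast
    field_simp
    ring

lemma continuousAt_radialKernel {n : ℕ} (hn : 2 ≤ n) {s : ℝ} (hs : 0 < s) :
    ContinuousAt (radialKernel n) s := (hasDerivAt_radialKernel hn hs).continuousAt

lemma continuousOn_radialKernel {n : ℕ} (hn : 2 ≤ n) :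
    ContinuousOn (radialKernel n) (Set.Ioi 0) :=
  fun _ hs => (continuousAt_radialKernel hn hs).continuousWithinAt

lemma antitoneOn_radialKernel {n : ℕ} (hn : 2 ≤ n) :
    AntitoneOn (radialKernel n) (Set.Ioi 0) := by
  refine antitoneOn_of_deriv_nonpos (convex_Ioi 0) (continuousOn_radialKernel hn) ?_ ?_
  · intro s hs
    rw [interior_Ioi] at hs
    exact (hasDerivAt_radialKernel hn hs).differentiableAt.differentiableWithinAt
  · intro s hs
    rw [interior_Ioi] at hs
    rw [(hasDerivAt_radialKernel hn hs).deriv]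
    have := sphereArea_pos hn
    have h2 : 0 < s := hs
    simp only [Left.neg_nonpos_iff]
    positivity

/-- Homogeneity of degree 2 - n, which for the logarithm becomes an additive constant. This constant
is the source of every special term in dimension two. -/
lemma radialKernel_mul {n : ℕ} {b s : ℝ} (hb : 0 < b) (hs : 0 < s) :
    radialKernel n (b * s) =
      (b ^ (n - 2))⁻¹ * radialKernel n s + if n = 2 then radialKernel n b else 0 := by
  by_cases h : n = 2
  · subst h
    simp only [radialKernel, if_true, Real.log_mul hb.ne' hs.ne']
    simp
    ring
  · simp only [radialKernel, if_neg h, mul_pow, one_div, mul_inv]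
    ring

lemma measurable_radialKernel (n : ℕ) : Measurable (radialKernel n) := by
  unfold radialKernel
  split_ifs <;> fun_prop

lemma continuous_pow_mul_radialKernel {n : ℕ} (hn : 2 ≤ n) :
    Continuous fun s => s ^ (n - 1) * radialKernel n s := by
  rcases eq_or_lt_of_le hn with rfl | h3
  · have : (fun s : ℝ => s ^ (2 - 1) * radialKernel 2 s) =
        fun s => -(1 / (2 * Real.pi)) * (s * Real.log s) := by
      ext s; simp [radialKernel]; ring
    rw [this]
    exact continuous_const.mul Real.continuous_mul_log
  · obtain ⟨m, rfl⟩ : ∃ m, n = m + 3 := ⟨n - 3, by omega⟩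
    have : (fun s : ℝ => s ^ (m + 3 - 1) * radialKernel (m + 3) s) =
        fun s => ((((m + 3 : ℕ) : ℝ) - 2) * sphereArea (m + 3))⁻¹ * s := by
      ext s
      simp only [radialKernel]
      rw [if_neg (by omega), show m + 3 - 2 = m + 1 by omega, show m + 3 - 1 = m + 2 by omega,
        one_div, mul_inv]
      rcases eq_or_ne s 0 with rfl | h
      · simp
      · field_simp
        ring
    rw [this]
    fun_prop

/-! ### Local integrability and smoothness of the kernel. -/

lemma finrank_euclidean (n : ℕ) : Module.finrank ℝ (EuclideanSpace ℝ (Fin n)) = n := by simp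

lemma nontrivial_euclidean {n : ℕ} (hn : 2 ≤ n) : Nontrivial (EuclideanSpace ℝ (Fin n)) :=
  Module.nontrivial_of_finrank_pos (R := ℝ) (by rw [finrank_euclidean]; omega)

/-- A radial function `f ‖x‖` on `ℝⁿ` is locally integrable if `s ^ (n - 1) * f s` extends
continuously to `[0, ∞)`. -/
lemma locallyIntegrable_comp_norm {n : ℕ} (hn : 2 ≤ n) {f g : ℝ → ℝ}
    (hg : Continuous g) (hfg : ∀ s, 0 < s → s ^ (n - 1) * f s = g s) :
    LocallyIntegrable (fun x : EuclideanSpace ℝ (Fin n) => f ‖x‖) := by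
  have := nontrivial_euclidean hn
  rw [locallyIntegrable_iff]
  intro K hK
  obtain ⟨r, hr⟩ := hK.isBounded.subset_ball (0 : EuclideanSpace ℝ (Fin n))
  refine IntegrableOn.mono_set ?_ hr
  rw [integrableOn_fun_norm_addHaar, finrank_euclidean]
  refine IntegrableOn.congr_fun (f := g) ?_ ?_ measurableSet_Ioo
  · exact (hg.integrableOn_Icc (a := 0) (b := r)).mono_set Set.Ioo_subset_Icc_self
  · intro s hs
    exact (hfg s hs.1).symm

lemma locallyIntegrable_newtonKernel {n : ℕ} (hn : 2 ≤ n) :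
    LocallyIntegrable (newtonKernel n) :=
  locallyIntegrable_comp_norm hn (f := radialKernel n) (continuous_pow_mul_radialKernel hn)
    fun _ _ => rfl

lemma contDiffAt_radialKernel {n : ℕ} (hn : 2 ≤ n) {s : ℝ} (hs : 0 < s) {N : WithTop ℕ∞} :
    ContDiffAt ℝ N (radialKernel n) s := by
  unfold radialKernel
  by_cases h : n = 2
  · simp only [h, if_true]
    exact contDiffAt_const.mul (Real.contDiffAt_log.2 hs.ne')
  · simp only [h, if_false]
    have h3 : (n : ℝ) - 2 ≠ 0 := by
      have : (n : ℝ) ≠ 2 := by exact_mod_cast h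
      exact sub_ne_zero.2 this
    refine contDiffAt_const.div (contDiffAt_const.mul (contDiffAt_id.pow _)) ?_
    have := sphereArea_pos hn
    positivity

/-! ### The Laplacian in coordinates and integration by parts. -/

lemma laplacian_eq_sum_fderiv {n : ℕ} {φ : EuclideanSpace ℝ (Fin n) → ℝ} {x : EuclideanSpace ℝ (Fin n)}
    (hφ : ContDiffAt ℝ 2 φ x) :
    (Δ φ) x = ∑ i, fderiv ℝ (fun z => fderiv ℝ φ z (EuclideanSpace.basisFun (Fin n) ℝ i)) x
      (EuclideanSpace.basisFun (Fin n) ℝ i) := by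
  rw [InnerProductSpace.laplacian_eq_iteratedFDeriv_orthonormalBasis φ
    (EuclideanSpace.basisFun (Fin n) ℝ)]
  refine Finset.sum_congr rfl fun i _ => ?_
  rw [iteratedFDeriv_two_apply, fderiv_clm_apply]
  · simp
  · exact (hφ.fderiv_right (m := 1) (by norm_num)).differentiableAt (by norm_num)
  · exact differentiableAt_const _

/-- Coordinate-free form of the integration by parts `∫ ψ Δφ = -∫ ∇ψ · ∇φ`. -/
lemma integral_mul_laplacian {n : ℕ} {ψ φ : EuclideanSpace ℝ (Fin n) → ℝ}
    (hψ : ContDiff ℝ 1 ψ) (hφ : ContDiff ℝ 2 φ) (hc : HasCompactSupport φ) :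
    ∫ x, ψ x * (Δ φ) x = -∫ x, ∑ i, fderiv ℝ ψ x (EuclideanSpace.basisFun (Fin n) ℝ i) *
      fderiv ℝ φ x (EuclideanSpace.basisFun (Fin n) ℝ i) := by
  have hd : ∀ v, ContDiff ℝ 1 (fun z => fderiv ℝ φ z v) := fun v =>
    (hφ.fderiv_right (m := 1) (by norm_num)).clm_apply contDiff_const
  have hdc : ∀ v, HasCompactSupport (fun z => fderiv ℝ φ z v) := fun v =>
    hc.fderiv_apply (𝕜 := ℝ) v
  have hddc : ∀ v w, HasCompactSupport (fun x => fderiv ℝ (fun z => fderiv ℝ φ z v) x w) :=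
    fun v w => (hdc v).fderiv_apply (𝕜 := ℝ) w
  have i1 : ∀ v, Integrable (fun x => ψ x * fderiv ℝ (fun z => fderiv ℝ φ z v) x v) := fun v =>
    (hψ.continuous.mul (((hd v).continuous_fderiv (by norm_num)).clm_apply
      continuous_const)).integrable_of_hasCompactSupport ((hddc v v).mul_left)
  have i2 : ∀ v, Integrable (fun x => fderiv ℝ ψ x v * fderiv ℝ φ x v) := fun v =>
    (((hψ.continuous_fderiv (by norm_num)).clm_apply continuous_const).mul
      (hd v).continuous).integrable_of_hasCompactSupport (hdc v).mul_left
  have i3 : ∀ v, Integrable (fun x => ψ x * fderiv ℝ φ x v) := fun v =>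
    (hψ.continuous.mul (hd v).continuous).integrable_of_hasCompactSupport (hdc v).mul_left
  simp_rw [laplacian_eq_sum_fderiv hφ.contDiffAt, Finset.mul_sum]
  rw [integral_finsetSum _ fun i _ => i1 _, integral_finsetSum _ fun i _ => i2 _,
    ← Finset.sum_neg_distrib]
  refine Finset.sum_congr rfl fun i _ => ?_
  exact integral_mul_fderiv_eq_neg_fderiv_mul_of_integrable (i2 _) (i1 _) (i3 _)
    (fun x _ => hψ.differentiable (by norm_num) x)
    (fun x _ => (hd _).differentiable (by norm_num) x)

lemma contDiff_laplacian_continuous {n : ℕ} {φ : EuclideanSpace ℝ (Fin n) → ℝ}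
    (hφ : ContDiff ℝ 2 φ) : Continuous (Δ φ) := by
  rw [InnerProductSpace.laplacian_eq_iteratedFDeriv_orthonormalBasis φ
    (EuclideanSpace.basisFun (Fin n) ℝ)]
  have := hφ.continuous_iteratedFDeriv (m := 2) le_rfl
  fun_prop

lemma tsupport_laplacian_subset {n : ℕ} (φ : EuclideanSpace ℝ (Fin n) → ℝ) :
    tsupport (Δ φ) ⊆ tsupport φ := by
  refine closure_minimal ?_ (isClosed_tsupport φ)
  rw [InnerProductSpace.laplacian_eq_iteratedFDeriv_orthonormalBasis φ
    (EuclideanSpace.basisFun (Fin n) ℝ)]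
  intro x hx
  by_contra h
  refine hx ?_
  have : iteratedFDeriv ℝ 2 φ x = 0 := by
    by_contra h2
    exact h (support_iteratedFDeriv_subset 2 h2)
  simp [this]

lemma hasCompactSupport_laplacian {n : ℕ} {φ : EuclideanSpace ℝ (Fin n) → ℝ}
    (hc : HasCompactSupport φ) : HasCompactSupport (Δ φ) :=
  hc.of_isClosed_subset (isClosed_tsupport _) (tsupport_laplacian_subset φ)

/-! ### The fundamental solution: -ΔΓ = δ. -/

/-- Polar coordinates. -/
lemma integral_eq_integral_sphere {n : ℕ} (hn : 2 ≤ n) {f : EuclideanSpace ℝ (Fin n) → ℝ}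
    (hf : Integrable f) :
    ∫ x, f x = ∫ s : Metric.sphere (0 : EuclideanSpace ℝ (Fin n)) 1,
      (∫ r in Set.Ioi (0 : ℝ), r ^ (n - 1) * f (r • (s : EuclideanSpace ℝ (Fin n))))
        ∂(volume : Measure (EuclideanSpace ℝ (Fin n))).toSphere := by
  have := nontrivial_euclidean hn
  set μ : Measure (EuclideanSpace ℝ (Fin n)) := volume
  set e := homeomorphUnitSphereProd (EuclideanSpace ℝ (Fin n))
  have hmp := μ.measurePreserving_homeomorphUnitSphereProd
  have hemb := e.measurableEmbedding
  have hcomp : ∀ x, ((e.symm (e x) : ({0}ᶜ : Set (EuclideanSpace ℝ (Fin n)))) : EuclideanSpace ℝ (Fin n)) = x := by simp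
  have hint : Integrable (fun p => f (e.symm p : ({0}ᶜ : Set (EuclideanSpace ℝ (Fin n)))))
      (μ.toSphere.prod (.volumeIoiPow (Module.finrank ℝ (EuclideanSpace ℝ (Fin n)) - 1))) := by
    rw [← hmp.integrable_comp_emb hemb]
    simp only [Function.comp_def]
    simp_rw [show ∀ x, homeomorphUnitSphereProd (EuclideanSpace ℝ (Fin n)) x = e x from fun _ => rfl, hcomp]
    have : IntegrableOn f ({0}ᶜ : Set (EuclideanSpace ℝ (Fin n))) := hf.integrableOn
    rwa [integrableOn_iff_comap_subtypeVal (measurableSet_singleton _).compl] at this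
  calc
    ∫ x, f x ∂μ = ∫ x : ({(0)}ᶜ : Set (EuclideanSpace ℝ (Fin n))), f x ∂(μ.comap (↑)) := by
      rw [integral_subtype_comap (measurableSet_singleton _).compl f, restrict_compl_singleton]
    _ = ∫ p, f (e.symm p : ({0}ᶜ : Set (EuclideanSpace ℝ (Fin n)))) ∂(μ.toSphere.prod
          (.volumeIoiPow (Module.finrank ℝ (EuclideanSpace ℝ (Fin n)) - 1))) := by
      rw [← hmp.integral_comp hemb]
      simp_rw [show ∀ x, homeomorphUnitSphereProd (EuclideanSpace ℝ (Fin n)) x = e x from fun _ => rfl, hcomp]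
    _ = _ := by
      rw [integral_prod _ hint]
      refine integral_congr_ae (Eventually.of_forall fun s => ?_)
      simp only [e, homeomorphUnitSphereProd_symm_apply_coe]
      simp only [Measure.volumeIoiPow, ENNReal.ofReal]
      rw [integral_withDensity_eq_integral_smul (by fun_prop),
        integral_subtype_comap measurableSet_Ioi fun r : ℝ => Real.toNNReal (r ^
          (Module.finrank ℝ (EuclideanSpace ℝ (Fin n)) - 1)) • f (r • (s : EuclideanSpace ℝ (Fin n)))]
      refine setIntegral_congr_fun measurableSet_Ioi fun r hr => ?_
      simp only [finrank_euclidean]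
      rw [NNReal.smul_def, Real.coe_toNNReal _ (pow_nonneg hr.out.le _), smul_eq_mul]

/-- The regularized fundamental solution integrates by parts. -/
lemma integral_radialKernel_sqrt_mul_laplacian {n : ℕ} (hn : 2 ≤ n)
    {φ : EuclideanSpace ℝ (Fin n) → ℝ} (hφ : ContDiff ℝ 2 φ) (hc : HasCompactSupport φ)
    {ε : ℝ} (hε : 0 < ε) :
    ∫ x, radialKernel n (√(‖x‖ ^ 2 + ε)) * (Δ φ) x =
      ∫ x, (sphereArea n * √(‖x‖ ^ 2 + ε) ^ n)⁻¹ * fderiv ℝ φ x x := by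
  have hpos : ∀ x : EuclideanSpace ℝ (Fin n), 0 < ‖x‖ ^ 2 + ε := fun x => by positivity
  have hsq : ∀ x : EuclideanSpace ℝ (Fin n), 0 < √(‖x‖ ^ 2 + ε) := fun x => Real.sqrt_pos.2 (hpos x)
  have hψ : ContDiff ℝ 1 (fun x : EuclideanSpace ℝ (Fin n) => radialKernel n (√(‖x‖ ^ 2 + ε))) := by
    rw [contDiff_iff_contDiffAt]
    intro x
    refine (contDiffAt_radialKernel hn (hsq x)).comp x
      (f := fun x : EuclideanSpace ℝ (Fin n) => √(‖x‖ ^ 2 + ε)) ?_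
    exact ((contDiff_norm_sq ℝ).add contDiff_const).contDiffAt.sqrt (hpos x).ne'
  rw [integral_mul_laplacian hψ hφ hc, ← integral_neg]
  refine integral_congr_ae (Eventually.of_forall fun x => ?_)
  have hd : ∀ v, fderiv ℝ (fun x : EuclideanSpace ℝ (Fin n) => radialKernel n (√(‖x‖ ^ 2 + ε))) x v
      = -(sphereArea n * √(‖x‖ ^ 2 + ε) ^ n)⁻¹ * inner ℝ x v := by
    intro v
    have h1 : HasFDerivAt (fun x : EuclideanSpace ℝ (Fin n) => ‖x‖ ^ 2 + ε) (2 • innerSL ℝ x) x :=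
      ((hasStrictFDerivAt_norm_sq x).hasFDerivAt).add_const ε
    have h2 := h1.sqrt (hpos x).ne'
    have h3 := (hasDerivAt_radialKernel hn (hsq x)).comp_hasFDerivAt x h2
    have h4 := h3.fderiv
    simp only [Function.comp_def] at h4
    rw [h4]
    obtain ⟨m, rfl⟩ : ∃ m, n = m + 1 := ⟨n - 1, by omega⟩
    have := sphereArea_pos hn
    have := (hsq x).ne'
    simp only [Nat.add_sub_cancel, smul_apply, nsmul_eq_mul, innerSL_apply_apply, smul_eq_mul]
    push_cast
    field_simp
    ring
  simp only [hd]
  have hsum : fderiv ℝ φ x x = ∑ i, inner ℝ x (EuclideanSpace.basisFun (Fin n) ℝ i) *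
      fderiv ℝ φ x (EuclideanSpace.basisFun (Fin n) ℝ i) := by
    have h := congrArg (fderiv ℝ φ x) ((EuclideanSpace.basisFun (Fin n) ℝ).sum_repr' x)
    rw [← h, map_sum]
    refine Finset.sum_congr rfl fun i _ => ?_
    rw [map_smul, smul_eq_mul, real_inner_comm]
  rw [hsum, Finset.mul_sum, ← Finset.sum_neg_distrib]
  refine Finset.sum_congr rfl fun i _ => ?_
  ring

lemma norm_pow_inv_mul_fderiv_le {n : ℕ} (hn : 2 ≤ n) (φ : EuclideanSpace ℝ (Fin n) → ℝ)
    {x : EuclideanSpace ℝ (Fin n)} (hx : x ≠ 0) {s : ℝ} (hs : ‖x‖ ≤ s) :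
    ‖(sphereArea n * s ^ n)⁻¹ * fderiv ℝ φ x x‖ ≤
      (sphereArea n)⁻¹ * ((‖x‖ ^ (n - 1))⁻¹ * ‖fderiv ℝ φ x‖) := by
  have h0 : 0 < ‖x‖ := norm_pos_iff.2 hx
  have hω := sphereArea_pos hn
  have hs0 : 0 < s := h0.trans_le hs
  obtain ⟨m, rfl⟩ : ∃ m, n = m + 1 := ⟨n - 1, by omega⟩
  have h1 : ‖fderiv ℝ φ x x‖ ≤ ‖fderiv ℝ φ x‖ * ‖x‖ := (fderiv ℝ φ x).le_opNorm x
  rw [norm_mul, norm_inv, norm_mul, Real.norm_of_nonneg hω.le, Real.norm_of_nonneg (by positivity)]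
  calc (sphereArea (m + 1) * s ^ (m + 1))⁻¹ * ‖fderiv ℝ φ x x‖
      ≤ (sphereArea (m + 1) * ‖x‖ ^ (m + 1))⁻¹ * (‖fderiv ℝ φ x‖ * ‖x‖) := by gcongr
    _ = _ := by
      simp only [Nat.add_sub_cancel]
      field_simp
      ring

lemma integrable_norm_pow_inv_mul_norm_fderiv {n : ℕ} (hn : 2 ≤ n)
    {φ : EuclideanSpace ℝ (Fin n) → ℝ} (hφ : ContDiff ℝ 2 φ) (hc : HasCompactSupport φ) :
    Integrable (fun x => (sphereArea n)⁻¹ * ((‖x‖ ^ (n - 1))⁻¹ * ‖fderiv ℝ φ x‖)) := by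
  refine Integrable.const_mul ?_ _
  have h1 : LocallyIntegrable (fun x : EuclideanSpace ℝ (Fin n) => (‖x‖ ^ (n - 1))⁻¹) :=
    locallyIntegrable_comp_norm hn (f := fun s => (s ^ (n - 1))⁻¹) (g := fun _ => 1)
      continuous_const fun s hs => mul_inv_cancel₀ (by positivity)
  have h2 := h1.integrable_smul_right_of_hasCompactSupport
    (hφ.continuous_fderiv (by norm_num)).norm (hc.fderiv ℝ).norm
  simpa only [smul_eq_mul] using h2

lemma ae_ne_zero {n : ℕ} (hn : 2 ≤ n) : ∀ᵐ x : EuclideanSpace ℝ (Fin n), x ≠ 0 := by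
  have := nontrivial_euclidean hn
  simp [ae_iff]

lemma tendsto_sqrt_norm_sq_add {n : ℕ} (x : EuclideanSpace ℝ (Fin n)) :
    Tendsto (fun ε => √(‖x‖ ^ 2 + ε)) (𝓝[>] 0) (𝓝 ‖x‖) := by
  have : Continuous fun ε => √(‖x‖ ^ 2 + ε) := by fun_prop
  have h := this.tendsto 0
  simp only [add_zero, Real.sqrt_sq (norm_nonneg x)] at h
  exact h.mono_left nhdsWithin_le_nhds

lemma norm_le_sqrt_norm_sq_add {n : ℕ} (x : EuclideanSpace ℝ (Fin n)) {ε : ℝ} (hε : 0 < ε) :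
    ‖x‖ ≤ √(‖x‖ ^ 2 + ε) := Real.le_sqrt_of_sq_le (by linarith)

/-- Replacing |x| by √(|x|² + ε) removes the singularity, so integration by parts needs no excised
ball; dominated convergence then lets ε tend to 0 on both sides. -/
lemma integral_newtonKernel_mul_laplacian_aux {n : ℕ} (hn : 2 ≤ n)
    {φ : EuclideanSpace ℝ (Fin n) → ℝ} (hφ : ContDiff ℝ 2 φ) (hc : HasCompactSupport φ) :
    ∫ x, newtonKernel n x * (Δ φ) x = ∫ x, (sphereArea n * ‖x‖ ^ n)⁻¹ * fderiv ℝ φ x x := by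
  have hΔ := contDiff_laplacian_continuous hφ
  have hΔc := hasCompactSupport_laplacian hc
  have hgrad : Continuous (fun x => fderiv ℝ φ x x) :=
    (hφ.continuous_fderiv (by norm_num)).clm_apply continuous_id
  have hsq1 : ∀ x : EuclideanSpace ℝ (Fin n), 0 < √(‖x‖ ^ 2 + 1) := fun x =>
    Real.sqrt_pos.2 (by positivity)
  have hL : Tendsto (fun ε => ∫ x, radialKernel n (√(‖x‖ ^ 2 + ε)) * (Δ φ) x) (𝓝[>] 0)
      (𝓝 (∫ x, newtonKernel n x * (Δ φ) x)) := by
    refine tendsto_integral_filter_of_dominated_convergence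
      (fun x => ‖newtonKernel n x * (Δ φ) x‖ + ‖radialKernel n (√(‖x‖ ^ 2 + 1)) * (Δ φ) x‖)
      (Eventually.of_forall fun ε => ?_) ?_ (Integrable.add ?_ ?_) ?_
    · exact (((measurable_radialKernel n).comp (by fun_prop)).mul hΔ.measurable).aestronglyMeasurable
    · have h1 : ∀ᶠ ε : ℝ in 𝓝[>] 0, 0 < ε ∧ ε ≤ 1 := by
        filter_upwards [Ioc_mem_nhdsGT (one_pos : (0 : ℝ) < 1)] with ε hε using hε
      filter_upwards [h1] with ε hε
      filter_upwards [ae_ne_zero hn] with x hx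
      have hx0 : 0 < ‖x‖ := norm_pos_iff.2 hx
      have hs := norm_le_sqrt_norm_sq_add x hε.1
      have hs0 := hx0.trans_le hs
      have hs1 : √(‖x‖ ^ 2 + ε) ≤ √(‖x‖ ^ 2 + 1) := Real.sqrt_le_sqrt (by linarith [hε.2])
      -- The kernel is decreasing, so for ε ≤ 1 its regularized value lies between the values at
      -- √(|x|² + 1) and at |x|; this yields a majorant independent of ε.
      have a1 := antitoneOn_radialKernel hn hx0 hs0 hs
      have a2 := antitoneOn_radialKernel hn hs0 (hsq1 x) hs1
      simp only [norm_mul, ← add_mul]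
      gcongr
      rw [newtonKernel_eq]
      simp only [Real.norm_eq_abs]
      rw [abs_le]
      constructor
      · linarith [neg_abs_le (radialKernel n (√(‖x‖ ^ 2 + 1))), abs_nonneg (radialKernel n ‖x‖)]
      · linarith [le_abs_self (radialKernel n ‖x‖), abs_nonneg (radialKernel n (√(‖x‖ ^ 2 + 1)))]
    · have := (locallyIntegrable_newtonKernel hn).integrable_smul_right_of_hasCompactSupport hΔ hΔc
      simpa only [smul_eq_mul] using this.norm
    · refine Integrable.norm (Continuous.integrable_of_hasCompactSupport (.mul ?_ hΔ) hΔc.mul_left)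
      exact (continuousOn_radialKernel hn).comp_continuous (by fun_prop) hsq1
    · filter_upwards [ae_ne_zero hn] with x hx
      exact ((continuousAt_radialKernel hn (norm_pos_iff.2 hx)).tendsto.comp
        (tendsto_sqrt_norm_sq_add x)).mul_const _
  have hR : Tendsto (fun ε => ∫ x, (sphereArea n * √(‖x‖ ^ 2 + ε) ^ n)⁻¹ * fderiv ℝ φ x x) (𝓝[>] 0)
      (𝓝 (∫ x, (sphereArea n * ‖x‖ ^ n)⁻¹ * fderiv ℝ φ x x)) := by
    refine tendsto_integral_filter_of_dominated_convergence
      (fun x => (sphereArea n)⁻¹ * ((‖x‖ ^ (n - 1))⁻¹ * ‖fderiv ℝ φ x‖))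
      (Eventually.of_forall fun ε => ?_) ?_ (integrable_norm_pow_inv_mul_norm_fderiv hn hφ hc) ?_
    · exact (Measurable.mul (by fun_prop) hgrad.measurable).aestronglyMeasurable
    · filter_upwards [self_mem_nhdsWithin] with ε hε
      filter_upwards [ae_ne_zero hn] with x hx
      exact norm_pow_inv_mul_fderiv_le hn φ hx (norm_le_sqrt_norm_sq_add x hε)
    · filter_upwards [ae_ne_zero hn] with x hx
      refine Tendsto.mul_const _ (Tendsto.inv₀ (((tendsto_sqrt_norm_sq_add x).pow n).const_mul _) ?_)
      have := sphereArea_pos hn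
      have := norm_pos_iff.2 hx
      positivity
  refine tendsto_nhds_unique hL (hR.congr' ?_)
  filter_upwards [self_mem_nhdsWithin] with ε hε
  exact (integral_radialKernel_sqrt_mul_laplacian hn hφ hc hε).symm

/-- In polar coordinates the Jacobian r^(n-1) cancels the singularity and leaves ω⁻¹ ∂ᵣφ on each
ray. The fundamental theorem of calculus gives -ω⁻¹ φ(0) per ray, and the sphere has area ω. -/
lemma integral_radial_derivative {n : ℕ} (hn : 2 ≤ n)
    {φ : EuclideanSpace ℝ (Fin n) → ℝ} (hφ : ContDiff ℝ 2 φ) (hc : HasCompactSupport φ) :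
    ∫ x, (sphereArea n * ‖x‖ ^ n)⁻¹ * fderiv ℝ φ x x = -φ 0 := by
  have hω := sphereArea_pos hn
  have hgrad : Continuous (fun x => fderiv ℝ φ x x) :=
    (hφ.continuous_fderiv (by norm_num)).clm_apply continuous_id
  have hint : Integrable (fun x => (sphereArea n * ‖x‖ ^ n)⁻¹ * fderiv ℝ φ x x) := by
    refine (integrable_norm_pow_inv_mul_norm_fderiv hn hφ hc).mono'
      (Measurable.mul (by fun_prop) hgrad.measurable).aestronglyMeasurable ?_
    filter_upwards [ae_ne_zero hn] with x hx
    exact norm_pow_inv_mul_fderiv_le hn φ hx le_rfl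
  rw [integral_eq_integral_sphere hn hint]
  have key : ∀ s : Metric.sphere (0 : EuclideanSpace ℝ (Fin n)) 1,
      ∫ r in Set.Ioi (0 : ℝ), r ^ (n - 1) * ((sphereArea n * ‖r • (s : EuclideanSpace ℝ (Fin n))‖ ^ n)⁻¹ *
        fderiv ℝ φ (r • (s : EuclideanSpace ℝ (Fin n))) (r • (s : EuclideanSpace ℝ (Fin n)))) = -(sphereArea n)⁻¹ * φ 0 := by
    intro s
    have hs : ‖(s : EuclideanSpace ℝ (Fin n))‖ = 1 := by simp
    have hcont : Continuous fun r : ℝ =>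
        fderiv ℝ φ (r • (s : EuclideanSpace ℝ (Fin n))) s :=
      ((hφ.continuous_fderiv (by norm_num)).comp (by fun_prop)).clm_apply continuous_const
    have hemb : Topology.IsClosedEmbedding fun r : ℝ => r • (s : EuclideanSpace ℝ (Fin n)) :=
      isClosedEmbedding_smul_left (by rw [← norm_ne_zero_iff, hs]; norm_num)
    have hd : ∀ r : ℝ, HasDerivAt (fun r : ℝ => φ (r • (s : EuclideanSpace ℝ (Fin n))))
        (fderiv ℝ φ (r • (s : EuclideanSpace ℝ (Fin n))) s) r := by
      intro r
      have h1 : HasDerivAt (fun r : ℝ => r • (s : EuclideanSpace ℝ (Fin n))) s r := by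
        simpa using (hasDerivAt_id r).smul_const (s : EuclideanSpace ℝ (Fin n))
      exact ((hφ.differentiable (by norm_num)) _).hasFDerivAt.comp_hasDerivAt r h1
    have hcs : HasCompactSupport fun r : ℝ => φ (r • (s : EuclideanSpace ℝ (Fin n))) :=
      hc.comp_isClosedEmbedding hemb
    have hcs' : HasCompactSupport fun r : ℝ => fderiv ℝ φ (r • (s : EuclideanSpace ℝ (Fin n))) s :=
      (hc.fderiv_apply (𝕜 := ℝ) (s : EuclideanSpace ℝ (Fin n))).comp_isClosedEmbedding hemb
    have h1 := integral_Ioi_of_hasDerivAt_of_tendsto (a := 0) (m := 0)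
      (f := fun r : ℝ => φ (r • (s : EuclideanSpace ℝ (Fin n))))
      (hd 0).continuousAt.continuousWithinAt (fun r _ => hd r)
      (hcont.integrable_of_hasCompactSupport hcs').integrableOn
      (hcs.is_zero_at_infty.mono_left atTop_le_cocompact)
    simp only [zero_smul, zero_sub] at h1
    rw [neg_mul, ← mul_neg, ← h1, ← integral_const_mul]
    refine setIntegral_congr_fun measurableSet_Ioi fun r hr => ?_
    have hr0 : 0 < r := hr
    obtain ⟨m, rfl⟩ : ∃ m, n = m + 1 := ⟨n - 1, by omega⟩
    simp only [norm_smul, hs, mul_one, Real.norm_of_nonneg hr0.le, map_smul, smul_eq_mul,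
      Nat.add_sub_cancel]
    field_simp
    ring
  simp_rw [key]
  rw [integral_const, ← sphereArea, smul_eq_mul]
  field_simp

/-- `-Δ Γ = δ₀`. -/
theorem integral_newtonKernel_sub_mul_laplacian {n : ℕ} (hn : 2 ≤ n)
    {φ : EuclideanSpace ℝ (Fin n) → ℝ} (hφ : ContDiff ℝ 2 φ) (hc : HasCompactSupport φ)
    (p : EuclideanSpace ℝ (Fin n)) :
    ∫ x, newtonKernel n (x - p) * (Δ φ) x = -φ p := by
  set φp : EuclideanSpace ℝ (Fin n) → ℝ := fun x => φ (x + p)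
  have hφp : ContDiff ℝ 2 φp := hφ.comp (contDiff_id.add contDiff_const)
  have hcp : HasCompactSupport φp := hc.comp_homeomorph (Homeomorph.addRight p)
  have hΔ : ∀ x, (Δ φp) x = (Δ φ) (x + p) := by
    intro x
    simp only [InnerProductSpace.laplacian_eq_iteratedFDeriv_orthonormalBasis _
      (EuclideanSpace.basisFun (Fin n) ℝ), φp]
    rw [iteratedFDeriv_comp_add_right]
  have h1 := integral_newtonKernel_mul_laplacian_aux hn hφp hcp
  rw [integral_radial_derivative hn hφp hcp] at h1
  simp only [hΔ] at h1
  rw [← integral_add_right_eq_self _ p]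
  simp only [add_sub_cancel_right]
  rw [h1]
  simp [φp]

/-! ### Maximum principle, mollification and uniqueness. -/

/-- At an interior maximum the Laplacian is nonpositive. -/
lemma laplacian_nonpos_of_isLocalMax {n : ℕ} {w : EuclideanSpace ℝ (Fin n) → ℝ}
    (hw : ContDiff ℝ 2 w) {x : EuclideanSpace ℝ (Fin n)} (hx : IsLocalMax w x) : (Δ w) x ≤ 0 := by
  rw [laplacian_eq_sum_fderiv hw.contDiffAt]
  refine Finset.sum_nonpos fun i _ => ?_
  set e := EuclideanSpace.basisFun (Fin n) ℝ i
  by_contra! hpos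
  set g : ℝ → ℝ := fun t => w (x + t • e)
  have hline : ∀ t : ℝ, HasDerivAt (fun t : ℝ => x + t • e) e t := fun t => by
    simpa using ((hasDerivAt_id t).smul_const e).const_add x
  have hg1 : deriv g = fun t => fderiv ℝ w (x + t • e) e := by
    ext t
    exact (((hw.differentiable (by norm_num)) _).hasFDerivAt.comp_hasDerivAt t (hline t)).deriv
  have hd : Differentiable ℝ (fun z => fderiv ℝ w z e) :=
    ((hw.fderiv_right (m := 1) (by norm_num)).clm_apply contDiff_const).differentiable (by norm_num)
  have hg2 : deriv (deriv g) 0 = fderiv ℝ (fun z => fderiv ℝ w z e) x e := by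
    rw [hg1]
    have := ((hd (x + (0 : ℝ) • e)).hasFDerivAt.comp_hasDerivAt 0 (hline 0)).deriv
    simpa [Function.comp_def] using this
  have hcont : Continuous fun t : ℝ => x + t • e := by fun_prop
  have hmax : IsLocalMax g 0 := by
    have : Tendsto (fun t : ℝ => x + t • e) (𝓝 0) (𝓝 x) := by
      simpa using hcont.tendsto 0
    have h := this.eventually hx
    simpa [IsLocalMax, IsMaxFilter, g] using h
  -- A positive second derivative would make 0 a local minimum as well as a local maximum; then g is
  -- constant near 0 and its second derivative vanishes.
  have hmin : IsLocalMin g 0 := isLocalMin_of_deriv_deriv_pos (by rw [hg2]; exact hpos)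
    hmax.deriv_eq_zero (hw.continuous.comp hcont).continuousAt
  have hconst : g =ᶠ[𝓝 0] fun _ => g 0 := by
    filter_upwards [hmax, hmin] with t h1 h2 using le_antisymm h1 h2
  have h0 : deriv (deriv g) 0 = 0 := by
    rw [hconst.deriv.deriv_eq]
    simp
  linarith [hg2]

lemma laplacian_norm_sq {n : ℕ} (x : EuclideanSpace ℝ (Fin n)) :
    (Δ fun x : EuclideanSpace ℝ (Fin n) => ‖x‖ ^ 2) x = (2 : ℝ) * n := by
  rw [laplacian_eq_sum_fderiv (contDiff_norm_sq ℝ).contDiffAt]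
  have h1 : ∀ z v : EuclideanSpace ℝ (Fin n),
      fderiv ℝ (fun x : EuclideanSpace ℝ (Fin n) => ‖x‖ ^ 2) z v = 2 * inner ℝ v z := by
    intro z v
    rw [(hasStrictFDerivAt_norm_sq z).hasFDerivAt.fderiv]
    simp [real_inner_comm]
  have h2 : ∀ z v : EuclideanSpace ℝ (Fin n),
      fderiv ℝ (fun z => 2 * inner ℝ v z) z v = 2 * inner ℝ v v := by
    intro z v
    have : HasFDerivAt (fun z : EuclideanSpace ℝ (Fin n) => 2 * inner ℝ v z)
      ((2 : ℝ) • innerSL ℝ v) z := ((innerSL ℝ v).hasFDerivAt).const_mul 2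
    rw [this.fderiv]
    simp
  simp only [h1, h2]
  simp [mul_comm]

/-- Weak maximum principle on a compact set. -/
lemma le_of_laplacian_eq_zero {n : ℕ} (hn : 2 ≤ n) {v : EuclideanSpace ℝ (Fin n) → ℝ}
    (hv : ContDiff ℝ 2 v) {K : Set (EuclideanSpace ℝ (Fin n))} (hK : IsCompact K)
    (hΔ : ∀ x ∈ interior K, (Δ v) x = 0) {M : ℝ} (hM : ∀ x ∈ K \ interior K, v x ≤ M)
    {x : EuclideanSpace ℝ (Fin n)} (hx : x ∈ K) : v x ≤ M := by
  obtain ⟨B, hB⟩ := hK.isBounded.exists_norm_le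
  have hB0 : 0 ≤ B := (norm_nonneg x).trans (hB x hx)
  by_contra! hlt
  -- Adding δ|z|² makes the Laplacian strictly positive in the interior, while δ is so small that
  -- δB² stays below the supposed excess v x - M.
  set δ := (v x - M) / (2 * (B ^ 2 + 1)) with hδ
  have hδ0 : 0 < δ := by
    have : 0 < v x - M := by linarith
    positivity
  have hδB : δ * B ^ 2 < v x - M := by
    have h1 : δ * (2 * (B ^ 2 + 1)) = v x - M := by rw [hδ]; field_simp
    nlinarith [sq_nonneg B]
  set w : EuclideanSpace ℝ (Fin n) → ℝ := v + δ • fun z => ‖z‖ ^ 2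
  have hw : ContDiff ℝ 2 w := hv.add ((contDiff_norm_sq ℝ).const_smul δ)
  obtain ⟨z, hzK, hz⟩ := hK.exists_isMaxOn ⟨x, hx⟩ hw.continuous.continuousOn
  have hzx : w x ≤ w z := hz hx
  have hwx : w x = v x + δ * ‖x‖ ^ 2 := by simp [w]
  have hwz : w z = v z + δ * ‖z‖ ^ 2 := by simp [w]
  by_cases hzi : z ∈ interior K
  · have hloc : IsLocalMax w z := hz.isLocalMax (mem_interior_iff_mem_nhds.1 hzi)
    have h1 := laplacian_nonpos_of_isLocalMax hw hloc
    have h2 : (Δ w) z = 2 * n * δ := by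
      have h5 : ContDiffAt ℝ 2 (δ • fun z : EuclideanSpace ℝ (Fin n) => ‖z‖ ^ 2) z :=
        ((contDiff_norm_sq ℝ).const_smul δ).contDiffAt
      rw [hv.contDiffAt.laplacian_add h5, hΔ z hzi,
        InnerProductSpace.laplacian_smul _ (contDiff_norm_sq ℝ).contDiffAt, laplacian_norm_sq]
      simp
      ring
    have h3 : 0 < (n : ℝ) := by exact_mod_cast (by omega : 0 < n)
    rw [h2] at h1
    have : 0 < 2 * n * δ := by positivity
    linarith
  · have h1 := hM z ⟨hzK, hzi⟩
    have h2 : ‖z‖ ^ 2 ≤ B ^ 2 := by gcongr; exact hB z hzK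
    have h3 : δ * ‖z‖ ^ 2 ≤ δ * B ^ 2 := by gcongr
    have h4 : 0 ≤ δ * ‖x‖ ^ 2 := by positivity
    linarith

lemma fderiv_comp_const_sub_apply {n : ℕ} {g : EuclideanSpace ℝ (Fin n) → ℝ}
    (hg : Differentiable ℝ g) (x t v : EuclideanSpace ℝ (Fin n)) :
    fderiv ℝ (fun t => g (x - t)) t v = -fderiv ℝ g (x - t) v := by
  have h := ((hg (x - t)).hasFDerivAt.comp t ((hasFDerivAt_id t).const_sub x)).fderiv
  simp only [Function.comp_def] at h
  rw [h]
  simp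

lemma laplacian_comp_const_sub {n : ℕ} {g : EuclideanSpace ℝ (Fin n) → ℝ}
    (hg : ContDiff ℝ 2 g) (x t : EuclideanSpace ℝ (Fin n)) :
    (Δ fun t => g (x - t)) t = (Δ g) (x - t) := by
  have hg' : ContDiff ℝ 2 (fun t => g (x - t)) := hg.comp (contDiff_const.sub contDiff_id)
  rw [laplacian_eq_sum_fderiv hg'.contDiffAt, laplacian_eq_sum_fderiv hg.contDiffAt]
  refine Finset.sum_congr rfl fun i _ => ?_
  set e := EuclideanSpace.basisFun (Fin n) ℝ i
  have hd : Differentiable ℝ (fun z => fderiv ℝ g z e) :=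
    ((hg.fderiv_right (m := 1) (by norm_num)).clm_apply contDiff_const).differentiable (by norm_num)
  simp only [fderiv_comp_const_sub_apply (hg.differentiable (by norm_num))]
  rw [fderiv_fun_neg, neg_apply, fderiv_comp_const_sub_apply hd, neg_neg]

open scoped Convolution in
lemma fderiv_convolution_apply {n : ℕ} {f g : EuclideanSpace ℝ (Fin n) → ℝ}
    (hf : LocallyIntegrable f) (hg : ContDiff ℝ 1 g) (hc : HasCompactSupport g)
    (x v : EuclideanSpace ℝ (Fin n)) :
    fderiv ℝ (f ⋆[ContinuousLinearMap.mul ℝ ℝ, volume] g) x v =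
      (f ⋆[ContinuousLinearMap.mul ℝ ℝ, volume] fun z => fderiv ℝ g z v) x := by
  rw [(hc.hasFDerivAt_convolution_right (ContinuousLinearMap.mul ℝ ℝ) hf hg x).fderiv]
  have hex := (hc.fderiv ℝ).convolutionExists_right
    ((ContinuousLinearMap.mul ℝ ℝ).precompR (EuclideanSpace ℝ (Fin n))) hf
    (hg.continuous_fderiv (by norm_num)) x
  rw [convolution_def, convolution_def, ContinuousLinearMap.integral_apply hex]
  rfl

-- Both derivatives fall on the mollifier, so the Laplacian of a mollified function is a pairing of
-- the function with a test function.
open scoped Convolution in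
lemma laplacian_convolution {n : ℕ} {f g : EuclideanSpace ℝ (Fin n) → ℝ}
    (hf : LocallyIntegrable f) (hg : ContDiff ℝ 2 g) (hc : HasCompactSupport g)
    (x : EuclideanSpace ℝ (Fin n)) :
    (Δ (f ⋆[ContinuousLinearMap.mul ℝ ℝ, volume] g)) x = ∫ t, f t * (Δ g) (x - t) := by
  have h2 : ContDiff ℝ 2 (f ⋆[ContinuousLinearMap.mul ℝ ℝ, volume] g) :=
    hc.contDiff_convolution_right _ hf hg
  have hd : ∀ v, ContDiff ℝ 1 (fun z => fderiv ℝ g z v) := fun v =>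
    (hg.fderiv_right (m := 1) (by norm_num)).clm_apply contDiff_const
  have hdc : ∀ v, HasCompactSupport (fun z => fderiv ℝ g z v) := fun v =>
    hc.fderiv_apply (𝕜 := ℝ) v
  rw [laplacian_eq_sum_fderiv h2.contDiffAt]
  simp_rw [fderiv_convolution_apply hf (hg.of_le (by norm_num)) hc,
    laplacian_eq_sum_fderiv hg.contDiffAt, Finset.mul_sum]
  rw [integral_finsetSum]
  · refine Finset.sum_congr rfl fun i _ => ?_
    exact fderiv_convolution_apply hf (hd _) (hdc _) x _
  · intro i _
    exact ((hdc _).fderiv_apply (𝕜 := ℝ) _).convolutionExists_right (ContinuousLinearMap.mul ℝ ℝ) hf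
      (((hd _).continuous_fderiv (by norm_num)).clm_apply continuous_const) x

open scoped Convolution in
/-- A distributional harmonic function on a bounded open set, continuous up to the boundary away
from one point `y` and vanishing on the boundary, is zero. -/
theorem eq_zero_of_distributional_harmonic {n : ℕ} (hn : 2 ≤ n)
    {Ω : Set (EuclideanSpace ℝ (Fin n))} (hΩ : IsOpen Ω) (hb : Bornology.IsBounded Ω)
    {u : EuclideanSpace ℝ (Fin n) → ℝ} {y : EuclideanSpace ℝ (Fin n)} (hy : y ∈ Ω)
    (hint : LocallyIntegrableOn u Ω)
    (hharm : ∀ φ : EuclideanSpace ℝ (Fin n) → ℝ, ContDiff ℝ ∞ φ → HasCompactSupport φ →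
      tsupport φ ⊆ Ω → ∫ x in Ω, u x * (Δ φ) x = 0)
    (hcont : ContinuousOn u (closure Ω \ {y})) (hbd : ∀ x ∈ frontier Ω, u x = 0)
    {x : EuclideanSpace ℝ (Fin n)} (hx : x ∈ Ω) (hxy : x ≠ y) : u x = 0 := by
  suffices h : ∀ η : ℝ, 0 < η → |u x| ≤ 2 * η by
    refine abs_nonpos_iff.1 (le_of_forall_pos_le_add fun ε hε => ?_)
    linarith [h (ε / 2) (by positivity)]
  intro η hη
  obtain ⟨U, hU, hUu⟩ := continuousOn_iff'.1 hcont {t | |t| < η}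
    (isOpen_lt continuous_abs continuous_const)
  have hUiff : ∀ z ∈ closure Ω, z ≠ y → (|u z| < η ↔ z ∈ U) := by
    intro z hz hzy
    have := Set.ext_iff.1 hUu z
    simpa [hz, hzy] using this
  -- C consists of y and the points where |u| ≥ η. The zero boundary values keep it inside Ω; y is
  -- included because u is not controlled there.
  set C := closure Ω ∩ (U \ {y})ᶜ
  have hCc : IsClosed C := isClosed_closure.inter (hU.sdiff isClosed_singleton).isClosed_compl
  have hC : IsCompact C := Metric.isCompact_of_isClosed_isBounded hCc
    (hb.closure.subset Set.inter_subset_left)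
  have hyC : y ∈ C := ⟨subset_closure hy, by simp⟩
  have hsmall : ∀ z ∈ closure Ω, z ∉ C → |u z| < η := by
    intro z hz hzC
    have hzU : z ∈ U \ {y} := by
      by_contra h
      exact hzC ⟨hz, h⟩
    exact (hUiff z hz hzU.2).2 hzU.1
  have hCΩ : C ⊆ Ω := by
    intro z hz
    by_contra hzΩ
    have hzf : z ∈ frontier Ω := by
      rw [frontier, hΩ.interior_eq]
      exact ⟨hz.1, hzΩ⟩
    have hzy : z ≠ y := fun h => hzΩ (h ▸ hy)
    refine hz.2 ⟨(hUiff z hz.1 hzy).1 ?_, hzy⟩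
    rw [hbd z hzf]
    simpa using hη
  by_cases hxC : x ∈ C
  swap
  · linarith [hsmall x (subset_closure hx) hxC]
  -- The maximum principle will be applied on L, whose boundary avoids C; the larger L' leaves room
  -- for mollification.
  obtain ⟨L, hL, hCL, hLΩ⟩ := exists_compact_between hC hΩ hCΩ
  obtain ⟨L', hL', hLL', hL'Ω⟩ := exists_compact_between hL hΩ hLΩ
  have hxL : x ∈ L := interior_subset (hCL hxC)
  set f := L'.indicator u
  have hf : Integrable f := by
    rw [integrable_indicator_iff hL'.measurableSet]
    exact hint.integrableOn_compact_subset hL'Ω hL'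
  have hB : IsCompact (L \ interior L) := hL.diff isOpen_interior
  obtain ⟨δ₁, hδ₁, h₁⟩ := hB.exists_cthickening_subset_open (isOpen_interior.sdiff hCc)
    (show L \ interior L ⊆ interior L' \ C from fun z hz => ⟨hLL' hz.1, fun h => hz.2 (hCL h)⟩)
  obtain ⟨δ₂, hδ₂, h₂⟩ := hL.exists_cthickening_subset_open isOpen_interior hLL'
  have hfx : ContinuousAt f x := by
    have h3 : ContinuousAt u x := by
      refine hcont.continuousAt (Filter.mem_of_superset ((hΩ.sdiff isClosed_singleton).mem_nhds
        ⟨hx, hxy⟩) ?_)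
      exact Set.sdiff_subset_sdiff_left subset_closure
    refine h3.congr ?_
    filter_upwards [isOpen_interior.mem_nhds (hLL' hxL)] with z hz
    exact (Set.indicator_of_mem (interior_subset hz) u).symm
  obtain ⟨δ₃, hδ₃, h₃⟩ := Metric.continuousAt_iff.1 hfx η hη
  -- The three radii keep averages over the boundary of L in the region |u| < η, averages over L
  -- inside L', and the average at x within η of u x.
  set δ := min δ₁ (min δ₂ δ₃)
  have hδ : 0 < δ := lt_min hδ₁ (lt_min hδ₂ hδ₃)
  set χ : ContDiffBump (0 : EuclideanSpace ℝ (Fin n)) := ⟨δ / 2, δ, half_pos hδ, half_lt_self hδ⟩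
  set ρ := χ.normed volume
  have hρ : ContDiff ℝ ∞ ρ := χ.contDiff_normed
  have hρ2 : ContDiff ℝ 2 ρ := contDiff_infty.1 hρ 2
  have hρc : HasCompactSupport ρ := χ.hasCompactSupport_normed
  set v := f ⋆[ContinuousLinearMap.mul ℝ ℝ, volume] ρ
  have hveq : ∀ z, v z = (ρ ⋆[ContinuousLinearMap.lsmul ℝ ℝ, volume] f) z := by
    intro z
    simp only [v]
    rw [convolution_def, convolution_lsmul_swap]
    refine integral_congr_ae (Eventually.of_forall fun t => ?_)
    simp [mul_comm]
  have hv : ContDiff ℝ 2 v := hρc.contDiff_convolution_right _ hf.locallyIntegrable hρ2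
  have hvΔ : ∀ z ∈ interior L, (Δ v) z = 0 := by
    -- The translated mollifier is a test function supported in L', where the truncation f agrees
    -- with u, so the distributional equation applies to it.
    intro z hz
    have hball : Metric.closedBall z δ ⊆ L' :=
      (Metric.closedBall_subset_closedBall ((min_le_right _ _).trans (min_le_left _ _))).trans
        ((Metric.closedBall_subset_cthickening (interior_subset hz) δ₂).trans
          (h₂.trans interior_subset))
    have hts : tsupport (fun t => ρ (z - t)) ⊆ Metric.closedBall z δ := by
      refine closure_minimal (fun t ht => ?_) Metric.isClosed_closedBall
      have : z - t ∈ Function.support ρ := ht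
      rw [χ.support_normed_eq] at this
      rw [Metric.mem_closedBall, dist_comm, dist_eq_norm]
      simpa using this.out.le
    have hsm : ContDiff ℝ ∞ fun t => ρ (z - t) := hρ.comp (contDiff_const.sub contDiff_id)
    have h := hharm (fun t => ρ (z - t)) hsm
      (HasCompactSupport.of_support_subset_isCompact (isCompact_closedBall z δ)
        ((subset_tsupport _).trans hts)) (hts.trans (hball.trans hL'Ω))
    rw [laplacian_convolution hf.locallyIntegrable hρ2 hρc, ← h, ← integral_indicator
      hΩ.measurableSet]
    refine integral_congr_ae (Eventually.of_forall fun t => ?_)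
    simp only [f]
    by_cases htL : t ∈ L'
    · rw [Set.indicator_of_mem htL, Set.indicator_of_mem (hL'Ω htL), laplacian_comp_const_sub hρ2]
    · have h0 : (Δ fun t => ρ (z - t)) t = 0 := by
        by_contra h0
        exact htL (hball (hts (tsupport_laplacian_subset _ (subset_tsupport _ h0))))
      rw [Set.indicator_of_notMem htL, zero_mul]
      by_cases htΩ : t ∈ Ω
      · rw [Set.indicator_of_mem htΩ, h0, mul_zero]
      · rw [Set.indicator_of_notMem htΩ]
  have hvB : ∀ z ∈ L \ interior L, |v z| ≤ η := by
    intro z hz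
    rw [hveq, ← Real.norm_eq_abs, ← dist_zero_right]
    refine dist_convolution_le (R := δ) hη.le χ.support_normed_eq.subset χ.nonneg_normed
      χ.integral_normed hf.aestronglyMeasurable fun t ht => ?_
    have htV : t ∈ interior L' \ C := h₁ (Metric.closedBall_subset_cthickening hz δ₁
      (Metric.closedBall_subset_closedBall (min_le_left _ _) (Metric.ball_subset_closedBall ht)))
    have htL := interior_subset htV.1
    rw [dist_zero_right, Real.norm_eq_abs]
    simp only [f]
    rw [Set.indicator_of_mem htL]
    exact (hsmall t (subset_closure (hL'Ω htL)) htV.2).le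
  have hvx : |v x| ≤ η := by
    rw [abs_le]
    constructor
    · have h := le_of_laplacian_eq_zero hn hv.neg hL (M := η) (fun z hz => ?_) (fun z hz => ?_) hxL
      · have h' : -v x ≤ η := h
        linarith
      · rw [show (fun x => -v x) = -v from rfl, InnerProductSpace.laplacian_neg, Pi.neg_apply,
          hvΔ z hz, neg_zero]
      · have := neg_le_of_abs_le (hvB z hz)
        linarith
    · exact le_of_laplacian_eq_zero hn hv hL hvΔ (fun z hz => le_of_abs_le (hvB z hz)) hxL
  have hvf : |v x - f x| ≤ η := by
    rw [hveq, ← Real.dist_eq]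
    refine χ.dist_normed_convolution_le hf.aestronglyMeasurable fun t ht => (h₃ ?_).le
    exact lt_of_lt_of_le ht.out ((min_le_right _ _).trans (min_le_right _ _))
  have hfu : f x = u x := Set.indicator_of_mem (interior_subset (hLL' hxL)) u
  rw [hfu] at hvf
  have h4 : u x = v x - (v x - u x) := by ring
  rw [h4]
  linarith [abs_sub (v x) (v x - u x)]

/-! ### Image charges and their distances. -/

/-- The potential at `x` of an image charge at `(β / α) • y`, up to normalization. -/
noncomputable def imageKernel (n : ℕ) (α β : ℝ) (x y : EuclideanSpace ℝ (Fin n)) : ℝ :=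
  radialKernel n ‖α • x - β • y‖

/-- The potential of the four image charges attached to the reflection parameter `q`. -/
noncomputable def imageTerm (n : ℕ) (q : ℝ) (x y : EuclideanSpace ℝ (Fin n)) : ℝ :=
  imageKernel n 1 q x y + imageKernel n q 1 x y - imageKernel n ‖y‖ (q / ‖y‖) x y -
    imageKernel n (q * ‖y‖) ‖y‖⁻¹ x y

/-- The regular part of the Green function of the annulus, obtained by the method of images. -/
noncomputable def annulusRegular (n : ℕ) (a : ℝ) (x y : EuclideanSpace ℝ (Fin n)) : ℝ :=
  (∑' k : ℕ, a ^ ((n - 2) * (k + 1)) * imageTerm n (a ^ (2 * (k + 1))) x y) -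
    imageKernel n ‖y‖ ‖y‖⁻¹ x y -
    (if n = 2 then Real.log ‖y‖ / Real.log a else 0) * newtonKernel n x

/-- The Green function of the annulus. -/
noncomputable def annulusGreen (n : ℕ) (a : ℝ) (x y : EuclideanSpace ℝ (Fin n)) : ℝ :=
  newtonKernel n (x - y) + annulusRegular n a x y

section Kernel

variable {n : ℕ} {α β : ℝ} {x y : EuclideanSpace ℝ (Fin n)}

lemma sub_le_norm_smul_sub_smul (hα : 0 ≤ α) (hβ : 0 ≤ β) :
    α * ‖x‖ - β * ‖y‖ ≤ ‖α • x - β • y‖ := by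
  have := norm_sub_norm_le (α • x) (β • y)
  rwa [norm_smul, norm_smul, Real.norm_of_nonneg hα, Real.norm_of_nonneg hβ] at this

lemma sub_le_norm_smul_sub_smul' (hα : 0 ≤ α) (hβ : 0 ≤ β) :
    β * ‖y‖ - α * ‖x‖ ≤ ‖α • x - β • y‖ := by
  rw [norm_sub_rev]
  exact sub_le_norm_smul_sub_smul hβ hα

lemma norm_smul_sub_smul_sq :
    ‖α • x - β • y‖ ^ 2 = α ^ 2 * ‖x‖ ^ 2 - 2 * (α * β) * inner ℝ x y + β ^ 2 * ‖y‖ ^ 2 := by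
  rw [norm_sub_sq_real, norm_smul, norm_smul, real_inner_smul_left, real_inner_smul_right,
    mul_pow, mul_pow, Real.norm_eq_abs, Real.norm_eq_abs, sq_abs, sq_abs]
  ring

/-- Expanding the square leaves only the coefficient αβ of the inner product and the sum of the
squared lengths. All coincidences between images on the two boundary spheres are checked this way.
-/
lemma norm_smul_sub_smul_congr {γ δ : ℝ} (h1 : α * β = γ * δ)
    (h2 : α ^ 2 * ‖x‖ ^ 2 + β ^ 2 * ‖y‖ ^ 2 = γ ^ 2 * ‖x‖ ^ 2 + δ ^ 2 * ‖y‖ ^ 2) :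
    ‖α • x - β • y‖ = ‖γ • x - δ • y‖ := by
  rw [← sq_eq_sq₀ (norm_nonneg _) (norm_nonneg _), norm_smul_sub_smul_sq, norm_smul_sub_smul_sq, h1]
  linarith

lemma imageKernel_congr {γ δ : ℝ} (h1 : α * β = γ * δ)
    (h2 : α ^ 2 * ‖x‖ ^ 2 + β ^ 2 * ‖y‖ ^ 2 = γ ^ 2 * ‖x‖ ^ 2 + δ ^ 2 * ‖y‖ ^ 2) :
    imageKernel n α β x y = imageKernel n γ δ x y := by
  rw [imageKernel, imageKernel, norm_smul_sub_smul_congr h1 h2]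

lemma imageKernel_mul {b : ℝ} (hb : 0 < b) (h : α • x ≠ β • y) :
    imageKernel n (b * α) (b * β) x y =
      (b ^ (n - 2))⁻¹ * imageKernel n α β x y + if n = 2 then radialKernel n b else 0 := by
  rw [imageKernel, mul_smul, mul_smul, ← smul_sub, norm_smul, Real.norm_of_nonneg hb.le,
    radialKernel_mul hb (norm_pos_iff.2 (sub_ne_zero.2 h)), imageKernel]

lemma imageKernel_one_one : imageKernel n 1 1 x y = newtonKernel n (x - y) := by
  simp [imageKernel, newtonKernel_eq]

lemma continuousAt_imageKernel (hn : 2 ≤ n) (h : 0 < ‖α • x - β • y‖) :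
    ContinuousAt (fun x => imageKernel n α β x y) x :=
  (continuousAt_radialKernel hn h).comp (f := fun x => ‖α • x - β • y‖) (by fun_prop)

lemma isOpen_annulus (n : ℕ) (a : ℝ) : IsOpen (annulus n a) :=
  (isOpen_lt continuous_const continuous_norm).inter (isOpen_lt continuous_norm continuous_const)

lemma isBounded_annulus (n : ℕ) (a : ℝ) : Bornology.IsBounded (annulus n a) :=
  (Metric.isBounded_ball (x := 0) (r := 1)).subset fun x hx => by simpa using hx.2

lemma closure_annulus_subset (n : ℕ) (a : ℝ) : closure (annulus n a) ⊆ {x | a ≤ ‖x‖ ∧ ‖x‖ ≤ 1} :=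
  closure_minimal (fun _ hx => ⟨hx.1.le, hx.2.le⟩)
    ((isClosed_le continuous_const continuous_norm).inter
      (isClosed_le continuous_norm continuous_const))

lemma norm_of_mem_frontier_annulus {a : ℝ} (hx : x ∈ frontier (annulus n a)) :
    ‖x‖ = a ∨ ‖x‖ = 1 := by
  rw [frontier, (isOpen_annulus n a).interior_eq] at hx
  have h := closure_annulus_subset n a hx.1
  by_contra! hne
  exact hx.2 ⟨lt_of_le_of_ne h.1 hne.1.symm, lt_of_le_of_ne h.2 hne.2⟩

end Kernel

/-! ### Distributional Laplacian of one image charge. -/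

section Weak

variable {n : ℕ} {φ : EuclideanSpace ℝ (Fin n) → ℝ}

lemma integral_laplacian_eq_zero (hφ : ContDiff ℝ 2 φ) (hc : HasCompactSupport φ) :
    ∫ x, (Δ φ) x = 0 := by
  have := integral_mul_laplacian (ψ := fun _ => (1 : ℝ)) contDiff_const hφ hc
  simpa using this

lemma locallyIntegrable_newtonKernel_sub (hn : 2 ≤ n) (p : EuclideanSpace ℝ (Fin n)) :
    LocallyIntegrable fun x => newtonKernel n (x - p) := by
  rw [locallyIntegrable_iff]
  intro K hK
  have h2 := (locallyIntegrable_newtonKernel hn).integrableOn_isCompact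
    (hK.image (f := fun x => x - p) (by fun_prop))
  have h3 := (measurePreserving_sub_right volume p).integrableOn_comp_preimage
    (MeasurableEquiv.subRight p).measurableEmbedding (f := newtonKernel n)
    (s := (fun x => x - p) '' K)
  rw [Set.preimage_image_eq _ (sub_left_injective)] at h3
  exact h3.2 h2

lemma integrable_newtonKernel_sub_mul_laplacian (hn : 2 ≤ n) (hφ : ContDiff ℝ 2 φ)
    (hc : HasCompactSupport φ) (p : EuclideanSpace ℝ (Fin n)) :
    Integrable fun x => newtonKernel n (x - p) * (Δ φ) x := by
  have := (locallyIntegrable_newtonKernel_sub hn p).integrable_smul_right_of_hasCompactSupport (contDiff_laplacian_continuous hφ)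
    (hasCompactSupport_laplacian hc)
  simpa only [smul_eq_mul] using this

/-- Homogeneity reduces an image to a translated kernel, plus a constant in dimension two that
integrates to zero against Δφ. The identity can fail at the singular point in dimension two, where
log 0 = 0 by convention. -/
lemma imageKernel_mul_laplacian_ae_eq (hn : 2 ≤ n) {α β : ℝ} (hα : 0 < α)
    (y : EuclideanSpace ℝ (Fin n)) :
    (fun x => imageKernel n α β x y * (Δ φ) x) =ᵐ[volume] fun x => (α ^ (n - 2))⁻¹ *
      (newtonKernel n (x - (β / α) • y) * (Δ φ) x) +
        (if n = 2 then radialKernel n α else 0) * (Δ φ) x := by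
  have := nontrivial_euclidean hn
  have hne : ∀ᵐ x : EuclideanSpace ℝ (Fin n), x ≠ (β / α) • y := by simp [ae_iff]
  filter_upwards [hne] with x hx
  have h := imageKernel_mul (α := 1) (β := β / α) (x := x) (y := y) hα (by simpa using hx)
  rw [mul_one, mul_div_cancel₀ _ hα.ne'] at h
  rw [h, imageKernel, one_smul, newtonKernel_eq]
  ring

lemma integrable_imageKernel_mul_laplacian (hn : 2 ≤ n) (hφ : ContDiff ℝ 2 φ)
    (hc : HasCompactSupport φ) {α β : ℝ} (hα : 0 < α) (y : EuclideanSpace ℝ (Fin n)) :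
    Integrable fun x => imageKernel n α β x y * (Δ φ) x := by
  refine Integrable.congr ?_ (imageKernel_mul_laplacian_ae_eq hn hα y).symm
  exact ((integrable_newtonKernel_sub_mul_laplacian hn hφ hc _).const_mul _).add
    (((contDiff_laplacian_continuous hφ).integrable_of_hasCompactSupport
      (hasCompactSupport_laplacian hc)).const_mul _)

lemma integral_imageKernel_mul_laplacian (hn : 2 ≤ n) (hφ : ContDiff ℝ 2 φ)
    (hc : HasCompactSupport φ) {α β : ℝ} (hα : 0 < α) (y : EuclideanSpace ℝ (Fin n)) :
    ∫ x, imageKernel n α β x y * (Δ φ) x = -(α ^ (n - 2))⁻¹ * φ ((β / α) • y) := by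
  rw [integral_congr_ae (imageKernel_mul_laplacian_ae_eq hn hα y), integral_add
    ((integrable_newtonKernel_sub_mul_laplacian hn hφ hc _).const_mul _)
    (((contDiff_laplacian_continuous hφ).integrable_of_hasCompactSupport
      (hasCompactSupport_laplacian hc)).const_mul _), integral_const_mul, integral_const_mul,
    integral_laplacian_eq_zero hφ hc, integral_newtonKernel_sub_mul_laplacian hn hφ hc]
  ring

lemma setIntegral_mul_laplacian {Ω : Set (EuclideanSpace ℝ (Fin n))} (h : tsupport φ ⊆ Ω)
    (u : EuclideanSpace ℝ (Fin n) → ℝ) : ∫ x in Ω, u x * (Δ φ) x = ∫ x, u x * (Δ φ) x := by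
  refine setIntegral_eq_integral_of_forall_compl_eq_zero fun x hx => ?_
  have : (Δ φ) x = 0 := by
    by_contra h0
    exact hx (h (tsupport_laplacian_subset φ (subset_tsupport _ h0)))
  rw [this, mul_zero]

/-- The alternative in `h` places the charge (β/α)y in the closed inner ball or outside the open
unit ball, away from the support of φ. -/
lemma integral_imageKernel_mul_laplacian_eq_zero (hn : 2 ≤ n) (hφ : ContDiff ℝ 2 φ)
    (hc : HasCompactSupport φ) {a : ℝ} (hs : tsupport φ ⊆ annulus n a) {α β : ℝ} (hα : 0 < α)
    (hβ : 0 ≤ β) {y : EuclideanSpace ℝ (Fin n)} (h : β * ‖y‖ ≤ α * a ∨ α ≤ β * ‖y‖) :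
    ∫ x, imageKernel n α β x y * (Δ φ) x = 0 := by
  rw [integral_imageKernel_mul_laplacian hn hφ hc hα]
  have h0 : φ ((β / α) • y) = 0 := by
    by_contra h0
    have h1 := hs (subset_tsupport _ h0)
    have h2 : ‖(β / α) • y‖ = β * ‖y‖ / α := by
      rw [norm_smul, Real.norm_of_nonneg (by positivity)]
      ring
    rcases h with h | h
    · have := h1.1
      rw [h2, lt_div_iff₀ hα] at this
      linarith
    · have := h1.2
      rw [h2, div_lt_one hα] at this
      linarith
  rw [h0, mul_zero]

end Weak

/-! ### Uniform convergence of the image series. -/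

lemma abs_radialKernel_sub_le {n : ℕ} (hn : 2 ≤ n) {d s t : ℝ} (hd : 0 < d) (hs : d ≤ s)
    (ht : d ≤ t) :
    |radialKernel n s - radialKernel n t| ≤ (sphereArea n * d ^ (n - 1))⁻¹ * |s - t| := by
  have hω := sphereArea_pos hn
  have h := (convex_Ici d).norm_image_sub_le_of_norm_hasDerivWithin_le (f := radialKernel n)
    (f' := fun s => -(sphereArea n * s ^ (n - 1))⁻¹) (C := (sphereArea n * d ^ (n - 1))⁻¹)
    (fun s hs => (hasDerivAt_radialKernel hn (hd.trans_le hs)).hasDerivWithinAt)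
    (fun s hs => ?_) ht hs
  · simpa using h
  · have hs' : d ≤ s := hs
    have : 0 < s := hd.trans_le hs'
    rw [norm_neg, Real.norm_of_nonneg (by positivity)]
    gcongr

lemma abs_radialKernel_le {n : ℕ} (hn : 2 ≤ n) {d s : ℝ} (hd : 0 < d) (hs : d ≤ s) (hs1 : s ≤ 1) :
    |radialKernel n s| ≤ |radialKernel n d| + |radialKernel n 1| := by
  have hs0 := hd.trans_le hs
  have h1 := antitoneOn_radialKernel hn hd hs0 hs
  have h2 := antitoneOn_radialKernel hn hs0 (Set.mem_Ioi.2 one_pos) hs1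
  rw [abs_le]
  constructor
  · linarith [neg_abs_le (radialKernel n 1), abs_nonneg (radialKernel n d)]
  · linarith [le_abs_self (radialKernel n d), abs_nonneg (radialKernel n 1)]

lemma radialKernel_two (s : ℝ) : radialKernel 2 s = -(1 / (2 * Real.pi)) * Real.log s := by
  simp [radialKernel]

section Annulus

variable {n : ℕ} {a : ℝ} {x y : EuclideanSpace ℝ (Fin n)}

/-- Distances to all image charges are bounded below on the closed annulus. -/
lemma image_dist_bounds (ha0 : 0 < a) (ha1 : a < 1) (hy : y ∈ annulus n a) {q : ℝ} (hq0 : 0 < q)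
    (hq : q ≤ a ^ 2) (hx : a ≤ ‖x‖ ∧ ‖x‖ ≤ 1) :
    a * (‖y‖ - a) ≤ ‖(1 : ℝ) • x - q • y‖ ∧ a * (‖y‖ - a) ≤ ‖q • x - (1 : ℝ) • y‖ ∧
    a * (‖y‖ - a) ≤ ‖‖y‖ • x - (q / ‖y‖) • y‖ ∧ a * (‖y‖ - a) ≤ ‖(q * ‖y‖) • x - ‖y‖⁻¹ • y‖ := by
  have hy0 : 0 < ‖y‖ := ha0.trans hy.1
  obtain ⟨hx1, hx2⟩ := hx
  obtain ⟨hy1, hy2⟩ := hy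
  have h1 := sub_le_norm_smul_sub_smul (x := x) (y := y) zero_le_one hq0.le
  have h2 := sub_le_norm_smul_sub_smul' (x := x) (y := y) hq0.le zero_le_one
  have h3 := sub_le_norm_smul_sub_smul (x := x) (y := y) hy0.le (β := q / ‖y‖) (by positivity)
  have h4 := sub_le_norm_smul_sub_smul' (x := x) (y := y) (α := q * ‖y‖) (β := ‖y‖⁻¹) (by positivity)
    (by positivity)
  rw [div_mul_cancel₀ _ hy0.ne'] at h3
  rw [inv_mul_cancel₀ hy0.ne'] at h4
  have e1 : q * ‖y‖ ≤ a ^ 2 * 1 := by gcongr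
  have e2 : q * ‖x‖ ≤ a ^ 2 * 1 := by gcongr
  have e3 : ‖y‖ * a ≤ ‖y‖ * ‖x‖ := by gcongr
  have e4 : q * ‖y‖ * ‖x‖ ≤ a ^ 2 * 1 * 1 := by gcongr
  have e5 : a * ‖y‖ ≤ 1 * ‖y‖ := by gcongr
  have e6 : a * ‖y‖ ≤ a * 1 := by gcongr
  refine ⟨?_, ?_, ?_, ?_⟩ <;> linarith

lemma norm_image_zero_pos (ha0 : 0 < a) (hy : y ∈ annulus n a) (hx : ‖x‖ ≤ 1) :
    0 < ‖‖y‖ • x - ‖y‖⁻¹ • y‖ := by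
  have hy0 : 0 < ‖y‖ := ha0.trans hy.1
  have h4 := sub_le_norm_smul_sub_smul' (x := x) (y := y) hy0.le (β := ‖y‖⁻¹) (by positivity)
  rw [inv_mul_cancel₀ hy0.ne'] at h4
  have : ‖y‖ * ‖x‖ ≤ ‖y‖ * 1 := by gcongr
  linarith [hy.2]

lemma image_ratio_pow_pos (ha0 : 0 < a) (k : ℕ) : 0 < a ^ (2 * (k + 1)) := by positivity

lemma image_ratio_pow_le (ha0 : 0 < a) (ha1 : a < 1) (k : ℕ) : a ^ (2 * (k + 1)) ≤ a ^ 2 :=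
  pow_le_pow_of_le_one ha0.le ha1.le (by omega)

/-- Each of the four kernels is within O(q) of its limit as q → 0, by the Lipschitz bound away from
0. The combined limit D is absorbed by the weight when n ≥ 3 and vanishes when n = 2. -/
lemma exists_image_term_bound (hn : 2 ≤ n) (ha0 : 0 < a) (ha1 : a < 1) (hy : y ∈ annulus n a) :
    ∃ C, 0 ≤ C ∧ ∀ (k : ℕ) (x : EuclideanSpace ℝ (Fin n)), a ≤ ‖x‖ ∧ ‖x‖ ≤ 1 →
      |a ^ ((n - 2) * (k + 1)) * imageTerm n (a ^ (2 * (k + 1))) x y| ≤ C * a ^ k := by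
  have hy0 : 0 < ‖y‖ := ha0.trans hy.1
  set d := a * (‖y‖ - a)
  have hd : 0 < d := mul_pos ha0 (sub_pos.2 hy.1)
  have hω := sphereArea_pos hn
  set K := (sphereArea n * d ^ (n - 1))⁻¹
  have hK : 0 < K := by positivity
  set B := |radialKernel n d| + |radialKernel n 1|
  have hB : 0 ≤ B := by positivity
  refine ⟨4 * K + 4 * B, by positivity, fun k x hx => ?_⟩
  set q := a ^ (2 * (k + 1))
  have hq0 : 0 < q := image_ratio_pow_pos ha0 k
  have hq : q ≤ a ^ 2 := image_ratio_pow_le ha0 ha1 k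
  have hqk : q ≤ a ^ k := pow_le_pow_of_le_one ha0.le ha1.le (by omega)
  have hx0 : 0 < ‖x‖ := ha0.trans_le hx.1
  obtain ⟨b1, b2, b3, b4⟩ := image_dist_bounds ha0 ha1 hy hq0 hq hx
  have e1 : d ≤ ‖x‖ := by nlinarith [hy.2, hx.1]
  have e2 : d ≤ ‖y‖ := by nlinarith [hy.2, hx.1]
  have e3 : d ≤ ‖y‖ * ‖x‖ := by nlinarith [hy.2, hx.1]
  have e4 : d ≤ 1 := e2.trans hy.2.le
  have dist1 : ∀ α β : ℝ, 0 ≤ α → 0 ≤ β → |‖α • x - β • y‖ - α * ‖x‖| ≤ β * ‖y‖ := by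
    intro α β hα hβ
    have h := abs_norm_sub_norm_le (α • x - β • y) (α • x)
    rwa [sub_sub_cancel_left, norm_neg, norm_smul, norm_smul, Real.norm_of_nonneg hα,
      Real.norm_of_nonneg hβ] at h
  have dist2 : ∀ α β : ℝ, 0 ≤ α → 0 ≤ β → |‖α • x - β • y‖ - β * ‖y‖| ≤ α * ‖x‖ := by
    intro α β hα hβ
    have h := abs_norm_sub_norm_le (β • y - α • x) (β • y)
    rwa [sub_sub_cancel_left, norm_neg, norm_smul, norm_smul, Real.norm_of_nonneg hα,
      Real.norm_of_nonneg hβ, norm_sub_rev] at h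
  have c1 : |imageKernel n 1 q x y - radialKernel n ‖x‖| ≤ K * q := by
    refine (abs_radialKernel_sub_le hn hd b1 e1).trans ?_
    have := dist1 1 q zero_le_one hq0.le
    rw [one_mul] at this
    gcongr
    exact this.trans (mul_le_of_le_one_right hq0.le hy.2.le)
  have c2 : |imageKernel n q 1 x y - radialKernel n ‖y‖| ≤ K * q := by
    refine (abs_radialKernel_sub_le hn hd b2 e2).trans ?_
    have := dist2 q 1 hq0.le zero_le_one
    rw [one_mul] at this
    gcongr
    exact this.trans (mul_le_of_le_one_right hq0.le hx.2)
  have c3 : |imageKernel n ‖y‖ (q / ‖y‖) x y - radialKernel n (‖y‖ * ‖x‖)| ≤ K * q := by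
    refine (abs_radialKernel_sub_le hn hd b3 e3).trans ?_
    have := dist1 ‖y‖ (q / ‖y‖) hy0.le (by positivity)
    rw [div_mul_cancel₀ _ hy0.ne'] at this
    gcongr
  have c4 : |imageKernel n (q * ‖y‖) ‖y‖⁻¹ x y - radialKernel n 1| ≤ K * q := by
    refine (abs_radialKernel_sub_le hn hd b4 e4).trans ?_
    have := dist2 (q * ‖y‖) ‖y‖⁻¹ (by positivity) (by positivity)
    rw [inv_mul_cancel₀ hy0.ne'] at this
    gcongr
    refine this.trans ?_
    rw [mul_assoc]
    exact mul_le_of_le_one_right hq0.le (mul_le_one₀ hy.2.le hx0.le hx.2)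
  set D := radialKernel n ‖x‖ + radialKernel n ‖y‖ - radialKernel n (‖y‖ * ‖x‖) - radialKernel n 1
  have hdiff : |imageTerm n q x y - D| ≤ 4 * K * q := by
    simp only [imageTerm, D]
    rw [abs_le] at *
    constructor <;> linarith [c1.1, c1.2, c2.1, c2.2, c3.1, c3.2, c4.1, c4.2]
  have hp0 : 0 ≤ a ^ ((n - 2) * (k + 1)) := by positivity
  have hp1 : a ^ ((n - 2) * (k + 1)) ≤ 1 := pow_le_one₀ ha0.le ha1.le
  have hD : a ^ ((n - 2) * (k + 1)) * |D| ≤ 4 * B * a ^ k := by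
    rcases eq_or_lt_of_le hn with rfl | h3
    -- In dimension two the weight is 1, so convergence rests on the exact cancellation log(|y||x|)
    -- = log|y| + log|x|.
    · have : D = 0 := by
        simp only [D, radialKernel_two, Real.log_mul hy0.ne' hx0.ne', Real.log_one]
        ring
      rw [this]
      simp only [abs_zero, mul_zero]
      positivity
    · have hD4 : |D| ≤ 4 * B := by
        have f1 := abs_radialKernel_le hn hd e1 hx.2
        have f2 := abs_radialKernel_le hn hd e2 hy.2.le
        have f3 := abs_radialKernel_le hn hd e3 (mul_le_one₀ hy.2.le hx0.le hx.2)
        have f4 := abs_radialKernel_le hn hd e4 le_rfl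
        simp only [D]
        rw [abs_le] at *
        constructor <;> linarith [f1.1, f1.2, f2.1, f2.2, f3.1, f3.2, f4.1, f4.2]
      have hpk : a ^ ((n - 2) * (k + 1)) ≤ a ^ k := by
        refine pow_le_pow_of_le_one ha0.le ha1.le ?_
        have : 1 * (k + 1) ≤ (n - 2) * (k + 1) := Nat.mul_le_mul_right _ (by omega)
        omega
      calc a ^ ((n - 2) * (k + 1)) * |D| ≤ a ^ k * (4 * B) := by gcongr
        _ = _ := by ring
  rw [abs_mul, abs_of_nonneg hp0]
  have h1 : |imageTerm n q x y| ≤ 4 * K * q + |D| := by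
    have := abs_add_le (imageTerm n q x y - D) D
    rw [sub_add_cancel] at this
    linarith
  calc a ^ ((n - 2) * (k + 1)) * |imageTerm n q x y|
      ≤ a ^ ((n - 2) * (k + 1)) * (4 * K * q) + a ^ ((n - 2) * (k + 1)) * |D| := by
        rw [← mul_add]
        gcongr
    _ ≤ 1 * (4 * K * a ^ k) + 4 * B * a ^ k := by gcongr
    _ = _ := by ring

lemma summable_const_mul_pow (ha0 : 0 < a) (ha1 : a < 1) (C : ℝ) :
    Summable fun k : ℕ => C * a ^ k := (summable_geometric_of_lt_one ha0.le ha1).mul_left C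

lemma summable_image_term (hn : 2 ≤ n) (ha0 : 0 < a) (ha1 : a < 1) (hy : y ∈ annulus n a)
    (hx : a ≤ ‖x‖ ∧ ‖x‖ ≤ 1) :
    Summable fun k : ℕ => a ^ ((n - 2) * (k + 1)) * imageTerm n (a ^ (2 * (k + 1))) x y := by
  obtain ⟨C, -, hC⟩ := exists_image_term_bound hn ha0 ha1 hy
  exact Summable.of_norm_bounded (summable_const_mul_pow ha0 ha1 C) fun k => hC k x hx

lemma continuousAt_imageTerm (hn : 2 ≤ n) (ha0 : 0 < a) (ha1 : a < 1) (hy : y ∈ annulus n a)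
    {q : ℝ} (hq0 : 0 < q) (hq : q ≤ a ^ 2) (hx : a ≤ ‖x‖ ∧ ‖x‖ ≤ 1) :
    ContinuousAt (fun x => imageTerm n q x y) x := by
  have hd : 0 < a * (‖y‖ - a) := mul_pos ha0 (sub_pos.2 hy.1)
  obtain ⟨b1, b2, b3, b4⟩ := image_dist_bounds ha0 ha1 hy hq0 hq hx
  exact (((continuousAt_imageKernel hn (hd.trans_le b1)).add
    (continuousAt_imageKernel hn (hd.trans_le b2))).sub
    (continuousAt_imageKernel hn (hd.trans_le b3))).sub
    (continuousAt_imageKernel hn (hd.trans_le b4))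

lemma continuousAt_newtonKernel (hn : 2 ≤ n) (hx : x ≠ 0) : ContinuousAt (newtonKernel n) x :=
  (continuousAt_radialKernel hn (norm_pos_iff.2 hx)).comp continuous_norm.continuousAt

lemma continuousOn_annulusRegular (hn : 2 ≤ n) (ha0 : 0 < a) (ha1 : a < 1)
    (hy : y ∈ annulus n a) :
    ContinuousOn (fun x => annulusRegular n a x y) {x | a ≤ ‖x‖ ∧ ‖x‖ ≤ 1} := by
  obtain ⟨C, -, hC⟩ := exists_image_term_bound hn ha0 ha1 hy
  refine (ContinuousOn.sub ?_ fun x hx => ?_).sub (continuousOn_const.mul fun x hx => ?_)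
  · refine continuousOn_tsum (fun k x hx => ?_) (summable_const_mul_pow ha0 ha1 C)
      fun k x hx => hC k x hx
    exact ((continuousAt_imageTerm hn ha0 ha1 hy (image_ratio_pow_pos ha0 k)
      (image_ratio_pow_le ha0 ha1 k) hx).const_mul _).continuousWithinAt
  · exact (continuousAt_imageKernel hn (norm_image_zero_pos ha0 hy hx.2)).continuousWithinAt
  · exact (continuousAt_newtonKernel hn
      (norm_pos_iff.1 (ha0.trans_le hx.1))).continuousWithinAt

end Annulus

/-! ### The image series is a Green function. -/

section Annulus

variable {n : ℕ} {a : ℝ} {x y : EuclideanSpace ℝ (Fin n)} {φ : EuclideanSpace ℝ (Fin n) → ℝ}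

lemma integrable_imageTerm_mul_laplacian (hn : 2 ≤ n) (hφ : ContDiff ℝ 2 φ)
    (hc : HasCompactSupport φ) {q : ℝ} (hq : 0 < q) (hy : 0 < ‖y‖) :
    Integrable fun x => imageTerm n q x y * (Δ φ) x := by
  simp only [imageTerm, sub_mul, add_mul]
  have h := fun {α β : ℝ} (hα : 0 < α) =>
    integrable_imageKernel_mul_laplacian (β := β) hn hφ hc hα y
  exact (((h one_pos).add (h hq)).sub (h hy)).sub (h (by positivity))

lemma integral_imageTerm_mul_laplacian (hn : 2 ≤ n) (ha0 : 0 < a) (ha1 : a < 1)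
    (hy : y ∈ annulus n a) (hφ : ContDiff ℝ 2 φ) (hc : HasCompactSupport φ)
    (hs : tsupport φ ⊆ annulus n a) {q : ℝ} (hq0 : 0 < q) (hq : q ≤ a ^ 2) :
    ∫ x, imageTerm n q x y * (Δ φ) x = 0 := by
  have hy0 : 0 < ‖y‖ := ha0.trans hy.1
  have h := fun {α β : ℝ} (hα : 0 < α) =>
    integrable_imageKernel_mul_laplacian (β := β) hn hφ hc hα y
  have hz := fun {α β : ℝ} => integral_imageKernel_mul_laplacian_eq_zero (α := α) (β := β)
    (y := y) hn hφ hc hs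
  obtain ⟨hy1, hy2⟩ := hy
  have e1 : q * ‖y‖ ≤ a ^ 2 * 1 := by gcongr
  have e2 : a * a ≤ a * ‖y‖ := by gcongr
  have e3 : a ^ 2 ≤ a * 1 := by rw [sq]; gcongr
  simp only [imageTerm, sub_mul, add_mul]
  have i2 : Integrable fun x => imageKernel n 1 q x y * (Δ φ) x + imageKernel n q 1 x y * (Δ φ) x :=
    (h one_pos).add (h hq0)
  have i3 : Integrable fun x => imageKernel n 1 q x y * (Δ φ) x + imageKernel n q 1 x y * (Δ φ) x -
      imageKernel n ‖y‖ (q / ‖y‖) x y * (Δ φ) x := i2.sub (h hy0)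
  rw [integral_sub i3 (h (by positivity)), integral_sub i2 (h hy0), integral_add (h one_pos) (h hq0),
    hz one_pos hq0.le (.inl (by linarith)), hz hq0 zero_le_one (.inr (by linarith)),
    hz hy0 (by positivity) (.inl (by rw [div_mul_cancel₀ _ hy0.ne']; linarith)),
    hz (by positivity) (by positivity) (.inr (by rw [inv_mul_cancel₀ hy0.ne']; linarith))]
  simp

lemma integral_tsum_eq_zero_of_dominated {X : Type*} [MeasurableSpace X] {μ : Measure X}
    {F : ℕ → X → ℝ} {b : ℕ → ℝ} {g : X → ℝ} (hF : ∀ k, Integrable (F k) μ) (hb : Summable b)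
    (hg : Integrable g μ) (hFb : ∀ k x, ‖F k x‖ ≤ b k * g x) (h0 : ∀ k, ∫ x, F k x ∂μ = 0) :
    Integrable (fun x => ∑' k, F k x) μ ∧ ∫ x, ∑' k, F k x ∂μ = 0 := by
  have hsum : ∀ x, Summable fun k => b k * g x := fun x => hb.mul_right _
  have hlim : ∀ x, HasSum (fun k => F k x) (∑' k, F k x) := fun x =>
    (Summable.of_norm_bounded (hsum x) fun k => hFb k x).hasSum
  have hbi : Integrable (fun x => ∑' k, b k * g x) μ := by
    simp only [tsum_mul_right]
    exact hg.const_mul _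
  constructor
  · refine hbi.mono' ?_ (ae_of_all _ fun x => ?_)
    · exact aestronglyMeasurable_of_tendsto_ae (u := atTop)
        (f := fun N x => ∑ k ∈ Finset.range N, F k x)
        (fun N => (integrable_finsetSum _ fun k _ => hF k).1)
        (ae_of_all _ fun x => (hlim x).tendsto_sum_nat)
    · exact tsum_of_norm_bounded (hsum x).hasSum fun k => hFb k x
  · have h := hasSum_integral_of_dominated_convergence (μ := μ) (F := F)
      (fun k x => b k * g x) (fun k => (hF k).1) (fun k => ae_of_all _ (hFb k))
      (ae_of_all _ hsum) hbi (ae_of_all _ hlim)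
    simp only [h0] at h
    exact h.unique hasSum_zero

lemma integral_tsum_imageTerm_mul_laplacian (hn : 2 ≤ n) (ha0 : 0 < a) (ha1 : a < 1)
    (hy : y ∈ annulus n a) (hφ : ContDiff ℝ 2 φ) (hc : HasCompactSupport φ)
    (hs : tsupport φ ⊆ annulus n a) :
    Integrable (fun x => (∑' k : ℕ, a ^ ((n - 2) * (k + 1)) *
      imageTerm n (a ^ (2 * (k + 1))) x y) * (Δ φ) x) ∧
    ∫ x, (∑' k : ℕ, a ^ ((n - 2) * (k + 1)) *
      imageTerm n (a ^ (2 * (k + 1))) x y) * (Δ φ) x = 0 := by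
  obtain ⟨C, hC0, hC⟩ := exists_image_term_bound hn ha0 ha1 hy
  have hy0 : 0 < ‖y‖ := ha0.trans hy.1
  have hΔi : Integrable fun x => ‖(Δ φ) x‖ :=
    ((contDiff_laplacian_continuous hφ).integrable_of_hasCompactSupport
      (hasCompactSupport_laplacian hc)).norm
  simp only [← tsum_mul_right]
  refine integral_tsum_eq_zero_of_dominated (b := fun k => C * a ^ k) (fun k => ?_)
    (summable_const_mul_pow ha0 ha1 C) hΔi (fun k x => ?_) fun k => ?_
  · simp only [mul_assoc]
    exact (integrable_imageTerm_mul_laplacian hn hφ hc (image_ratio_pow_pos ha0 k) hy0).const_mul _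
  · by_cases hx : x ∈ tsupport φ
    · have := hs hx
      rw [norm_mul]
      exact mul_le_mul_of_nonneg_right (hC k x ⟨this.1.le, this.2.le⟩) (norm_nonneg _)
    · have h0 : (Δ φ) x = 0 := by
        by_contra h0
        exact hx (tsupport_laplacian_subset φ (subset_tsupport _ h0))
      simp [h0]
  · simp only [mul_assoc]
    rw [integral_const_mul, integral_imageTerm_mul_laplacian hn ha0 ha1 hy hφ hc hs
      (image_ratio_pow_pos ha0 k) (image_ratio_pow_le ha0 ha1 k), mul_zero]

/-- `-Δ G(·, y) = δ_y` in the annulus. -/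
lemma integral_annulusGreen_mul_laplacian (hn : 2 ≤ n) (ha0 : 0 < a) (ha1 : a < 1)
    (hy : y ∈ annulus n a) (hφ : ContDiff ℝ 2 φ) (hc : HasCompactSupport φ)
    (hs : tsupport φ ⊆ annulus n a) :
    ∫ x, annulusGreen n a x y * (Δ φ) x = -φ y := by
  have hy0 : 0 < ‖y‖ := ha0.trans hy.1
  obtain ⟨s1, s2⟩ := integral_tsum_imageTerm_mul_laplacian hn ha0 ha1 hy hφ hc hs
  have h0 := integrable_newtonKernel_sub_mul_laplacian hn hφ hc y
  have h1 := integrable_imageKernel_mul_laplacian (β := ‖y‖⁻¹) hn hφ hc hy0 y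
  have h2 : Integrable fun x => newtonKernel n x * (Δ φ) x := by
    simpa using integrable_newtonKernel_sub_mul_laplacian hn hφ hc 0
  have e2 : ∫ x, newtonKernel n x * (Δ φ) x = 0 := by
    have h := integral_newtonKernel_sub_mul_laplacian hn hφ hc 0
    simp only [sub_zero] at h
    rw [h, neg_eq_zero]
    by_contra h0
    have := (hs (subset_tsupport _ h0)).1
    simp only [norm_zero] at this
    linarith
  have e1 : ∫ x, imageKernel n ‖y‖ ‖y‖⁻¹ x y * (Δ φ) x = 0 :=
    integral_imageKernel_mul_laplacian_eq_zero hn hφ hc hs hy0 (by positivity)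
      (.inr (by rw [inv_mul_cancel₀ hy0.ne']; exact hy.2.le))
  set c : ℝ := if n = 2 then Real.log ‖y‖ / Real.log a else 0 with hcdef
  simp only [annulusGreen, annulusRegular, ← hcdef, add_mul, sub_mul, mul_assoc c]
  have s3 : Integrable fun x => (∑' k : ℕ, a ^ ((n - 2) * (k + 1)) *
      imageTerm n (a ^ (2 * (k + 1))) x y) * (Δ φ) x - imageKernel n ‖y‖ ‖y‖⁻¹ x y * (Δ φ) x :=
    s1.sub h1
  have h3 : Integrable fun x => c * (newtonKernel n x * (Δ φ) x) := h2.const_mul _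
  have s4 : Integrable fun x => (∑' k : ℕ, a ^ ((n - 2) * (k + 1)) *
      imageTerm n (a ^ (2 * (k + 1))) x y) * (Δ φ) x - imageKernel n ‖y‖ ‖y‖⁻¹ x y * (Δ φ) x -
      c * (newtonKernel n x * (Δ φ) x) := s3.sub h3
  rw [integral_add h0 s4, integral_sub s3 h3,
    integral_sub s1 h1, integral_const_mul, e2, e1, s2,
    integral_newtonKernel_sub_mul_laplacian hn hφ hc]
  simp

/-- Charges that are mirror images in the unit sphere have equal scaled distances to x when |x| = 1,
so every `imageTerm` vanishes separately and y/|y|² cancels the pole. -/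
lemma annulusGreen_eq_zero_of_norm_eq_one (ha0 : 0 < a) (hy : y ∈ annulus n a) (hx : ‖x‖ = 1) :
    annulusGreen n a x y = 0 := by
  have hy0 : ‖y‖ ≠ 0 := (ha0.trans hy.1).ne'
  have hterm : ∀ q, imageTerm n q x y = 0 := by
    intro q
    have h1 : imageKernel n 1 q x y = imageKernel n (q * ‖y‖) ‖y‖⁻¹ x y :=
      imageKernel_congr (by field_simp) (by rw [hx]; field_simp; ring)
    have h2 : imageKernel n q 1 x y = imageKernel n ‖y‖ (q / ‖y‖) x y :=
      imageKernel_congr (by field_simp) (by rw [hx]; field_simp; ring)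
    rw [imageTerm, h1, h2]
    ring
  have h3 : imageKernel n ‖y‖ ‖y‖⁻¹ x y = newtonKernel n (x - y) := by
    rw [← imageKernel_one_one]
    exact imageKernel_congr (by field_simp) (by rw [hx]; field_simp; ring)
  have h4 : (if n = 2 then Real.log ‖y‖ / Real.log a else 0) * newtonKernel n x = 0 := by
    split_ifs with h
    · subst h
      rw [newtonKernel_eq, hx, radialKernel_two]
      simp
    · simp
  simp only [annulusGreen, annulusRegular, hterm, h3, h4]
  simp

lemma tendsto_pow_mul_radialKernel (hn : 2 ≤ n) (ha0 : 0 < a) (ha1 : a < 1) {f : ℕ → ℝ} {L : ℝ}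
    (hL : 0 < L) (hf : Tendsto f atTop (𝓝 L)) :
    Tendsto (fun k => a ^ ((n - 2) * k) * radialKernel n (f k)) atTop
      (𝓝 (if n = 2 then radialKernel n L else 0)) := by
  have h := (continuousAt_radialKernel hn hL).tendsto.comp hf
  split_ifs with h2
  · subst h2
    simpa [Function.comp_def] using h
  · have hp : Tendsto (fun k : ℕ => a ^ ((n - 2) * k)) atTop (𝓝 0) := by
      simp only [pow_mul]
      exact tendsto_pow_atTop_nhds_zero_of_lt_one (by positivity)
        (pow_lt_one₀ ha0.le ha1 (by omega))
    simpa using hp.mul h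

/-- On |x| = a, inversion in the inner sphere matches charges of different generations, so the sum
telescopes. The limits at infinity survive only in dimension two, where the logarithmic term of
`annulusRegular` removes what is left. -/
lemma annulusGreen_eq_zero_of_norm_eq (hn : 2 ≤ n) (ha0 : 0 < a) (ha1 : a < 1)
    (hy : y ∈ annulus n a) (hx : ‖x‖ = a) : annulusGreen n a x y = 0 := by
  have hy0 : 0 < ‖y‖ := ha0.trans hy.1
  have hx' : a ≤ ‖x‖ ∧ ‖x‖ ≤ 1 := ⟨hx.ge, hx.le.trans ha1.le⟩
  -- The additive defect of homogeneity under scaling by a. A and B are the weighted negative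
  -- charges, in terms of which the positive ones are expressed on |x| = a.
  set c : ℝ := if n = 2 then radialKernel n a else 0 with hc
  set A : ℕ → ℝ := fun k => a ^ ((n - 2) * k) * imageKernel n (a ^ (2 * k) * ‖y‖) ‖y‖⁻¹ x y
  set B : ℕ → ℝ := fun k => a ^ ((n - 2) * k) * imageKernel n ‖y‖ (a ^ (2 * k) / ‖y‖) x y
  have hcm : ∀ k, a ^ ((n - 2) * k) * c = c := by
    intro k
    rw [hc]
    split_ifs with h
    · simp [h]
    · simp
  have hne : ∀ {α β : ℝ}, 0 < ‖α • x - β • y‖ → α • x ≠ β • y := fun h =>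
    sub_ne_zero.1 (norm_pos_iff.1 h)
  have hA : ∀ k, a ^ ((n - 2) * (k + 1)) * imageKernel n 1 (a ^ (2 * (k + 1))) x y = A k + c := by
    intro k
    have hpos : 0 < ‖(a ^ (2 * k) * ‖y‖) • x - ‖y‖⁻¹ • y‖ := by
      have h4 := sub_le_norm_smul_sub_smul' (x := x) (y := y) (α := a ^ (2 * k) * ‖y‖) (β := ‖y‖⁻¹)
        (by positivity) (by positivity)
      rw [inv_mul_cancel₀ hy0.ne'] at h4
      have e1 : a ^ (2 * k) * ‖y‖ * ‖x‖ ≤ 1 * ‖y‖ * 1 := by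
        gcongr
        · exact pow_le_one₀ ha0.le ha1.le
        · exact hx'.2
      linarith [hy.2]
    have h1 : imageKernel n 1 (a ^ (2 * (k + 1))) x y =
        imageKernel n (a * (a ^ (2 * k) * ‖y‖)) (a * ‖y‖⁻¹) x y :=
      imageKernel_congr (by field_simp; ring) (by rw [hx]; field_simp; ring)
    rw [h1, imageKernel_mul ha0 (hne hpos), ← hc, mul_add, hcm]
    congr 1
    simp only [A]
    rw [mul_add, mul_one, pow_add]
    field_simp
  have hBne : ∀ k, 0 < ‖(a ^ (2 * k)) • x - (1 : ℝ) • y‖ := by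
    intro k
    have h4 := sub_le_norm_smul_sub_smul' (x := x) (y := y) (α := a ^ (2 * k)) (β := 1)
        (by positivity) zero_le_one
    have e1 : a ^ (2 * k) * ‖x‖ ≤ 1 * a := by
      gcongr
      · exact pow_le_one₀ ha0.le ha1.le
      · exact hx.le
    linarith [hy.1]
  have hB : ∀ k, a ^ ((n - 2) * k) * imageKernel n (a ^ (2 * k)) 1 x y = B (k + 1) - c := by
    intro k
    have h1 : imageKernel n ‖y‖ (a ^ (2 * (k + 1)) / ‖y‖) x y =
        imageKernel n (a * a ^ (2 * k)) (a * 1) x y :=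
      imageKernel_congr (by field_simp; ring) (by rw [hx]; field_simp; ring)
    simp only [B]
    rw [h1, imageKernel_mul ha0 (hne (hBne k)), ← hc, mul_add, hcm, mul_add, mul_one, pow_add]
    field_simp
    ring
  have hterm : ∀ k, a ^ ((n - 2) * (k + 1)) * imageTerm n (a ^ (2 * (k + 1))) x y =
      (A k - B (k + 1)) - (A (k + 1) - B (k + 1 + 1)) := by
    intro k
    rw [imageTerm, mul_sub, mul_sub, mul_add, hA, hB]
    simp only [A, B]
    ring
  have hAlim : Tendsto A atTop (𝓝 0) := by
    have hlim : Tendsto (fun k : ℕ => ‖(a ^ (2 * k) * ‖y‖) • x - ‖y‖⁻¹ • y‖) atTop (𝓝 1) := by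
      have hp : Tendsto (fun k : ℕ => a ^ (2 * k)) atTop (𝓝 0) := by
        simp only [pow_mul]
        exact tendsto_pow_atTop_nhds_zero_of_lt_one (by positivity)
          (pow_lt_one₀ ha0.le ha1 (by omega))
      have := (((hp.mul_const ‖y‖).smul_const x).sub_const (‖y‖⁻¹ • y)).norm
      simpa [norm_smul, hy0.ne'] using this
    have h := tendsto_pow_mul_radialKernel hn ha0 ha1 one_pos hlim
    have h1 : (if n = 2 then radialKernel n 1 else 0) = 0 := by
      split_ifs with h2
      · subst h2
        simp [radialKernel_two]
      · rfl
    rwa [h1] at h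
  have hBlim : Tendsto B atTop (𝓝 (c + if n = 2 then radialKernel n ‖y‖ else 0)) := by
    have hlim : Tendsto (fun k : ℕ => ‖‖y‖ • x - (a ^ (2 * k) / ‖y‖) • y‖) atTop (𝓝 (a * ‖y‖)) := by
      have hp : Tendsto (fun k : ℕ => a ^ (2 * k)) atTop (𝓝 0) := by
        simp only [pow_mul]
        exact tendsto_pow_atTop_nhds_zero_of_lt_one (by positivity)
          (pow_lt_one₀ ha0.le ha1 (by omega))
      have := (((hp.div_const ‖y‖).smul_const y).const_sub (‖y‖ • x)).norm
      simpa [norm_smul, hx, mul_comm] using this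
    have h := tendsto_pow_mul_radialKernel hn ha0 ha1 (mul_pos ha0 hy0) hlim
    have h1 : (if n = 2 then radialKernel n (a * ‖y‖) else 0) =
        c + if n = 2 then radialKernel n ‖y‖ else 0 := by
      rw [hc]
      split_ifs with h2
      · subst h2
        simp only [radialKernel_two, Real.log_mul ha0.ne' hy0.ne']
        ring
      · simp
    rwa [h1] at h
  have hsum : ∑' k : ℕ, a ^ ((n - 2) * (k + 1)) * imageTerm n (a ^ (2 * (k + 1))) x y =
      A 0 - B 1 + (c + if n = 2 then radialKernel n ‖y‖ else 0) := by
    refine tendsto_nhds_unique (summable_image_term hn ha0 ha1 hy hx').hasSum.tendsto_sum_nat ?_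
    simp only [hterm]
    simp_rw [Finset.sum_range_sub' (fun k => A k - B (k + 1))]
    have := (hAlim.sub ((tendsto_add_atTop_iff_nat 1).2 hBlim)).const_sub (A 0 - B 1)
    rwa [zero_sub, sub_neg_eq_add] at this
  -- The original pole is the case k = 0 of `hB`, so it cancels the -B 1 left by the telescoping.
  have h0 : newtonKernel n (x - y) = B 1 - c := by
    have := hB 0
    simpa [imageKernel_one_one] using this
  have hA0 : A 0 = imageKernel n ‖y‖ ‖y‖⁻¹ x y := by simp [A]
  have hlog : (if n = 2 then Real.log ‖y‖ / Real.log a else 0) * newtonKernel n x =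
      if n = 2 then radialKernel n ‖y‖ else 0 := by
    split_ifs with h2
    · subst h2
      have : Real.log a ≠ 0 := (Real.log_neg ha0 ha1).ne
      rw [newtonKernel_eq, hx, radialKernel_two, radialKernel_two]
      field_simp
    · simp
  rw [annulusGreen, annulusRegular, hsum, hlog, hA0, h0]
  ring

theorem isGreenFunction_annulusGreen (hn : 2 ≤ n) (ha0 : 0 < a) (ha1 : a < 1) :
    IsGreenFunction (annulus n a) (annulusGreen n a) where
  locallyIntegrableOn y hy := by
    refine ((locallyIntegrable_newtonKernel_sub hn y).locallyIntegrableOn _).add ?_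
    exact ((continuousOn_annulusRegular hn ha0 ha1 hy).mono
      (subset_closure.trans (closure_annulus_subset n a))).locallyIntegrableOn
      (isOpen_annulus n a).measurableSet
  neg_laplacian_eq_dirac y hy φ hφ hc hs := by
    simp only [mul_neg]
    rw [integral_neg, setIntegral_mul_laplacian hs fun x => annulusGreen n a x y,
      integral_annulusGreen_mul_laplacian hn ha0 ha1 hy (contDiff_infty.1 hφ 2) hc hs, neg_neg]
  continuousOn y hy := by
    refine ContinuousOn.add (fun x hx => ?_) ((continuousOn_annulusRegular hn ha0 ha1 hy).mono
      (Set.sdiff_subset.trans (closure_annulus_subset n a)))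
    have h : ContinuousAt (fun x => newtonKernel n (x - y)) x :=
      (continuousAt_newtonKernel hn (sub_ne_zero.2 hx.2)).comp (f := fun x => x - y) (by fun_prop)
    exact h.continuousWithinAt
  eq_zero_of_mem_frontier y hy x hx := by
    rcases norm_of_mem_frontier_annulus hx with h | h
    · exact annulusGreen_eq_zero_of_norm_eq hn ha0 ha1 hy h
    · exact annulusGreen_eq_zero_of_norm_eq_one ha0 hy h

/-- The explicit candidate proves existence, so the choice operator returns a genuine Green
function. -/
theorem isGreenFunction_greenFunction (hn : 2 ≤ n) (ha0 : 0 < a) (ha1 : a < 1) :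
    IsGreenFunction (annulus n a) (greenFunction (annulus n a)) :=
  Classical.epsilon_spec ⟨_, isGreenFunction_annulusGreen hn ha0 ha1⟩

/-! ### Uniqueness and identification of the Robin function. -/

/-- Uniqueness of the Green function of a bounded open set, off the diagonal. -/
theorem IsGreenFunction.eq_of_ne (hn : 2 ≤ n) {Ω : Set (EuclideanSpace ℝ (Fin n))}
    {G G' : EuclideanSpace ℝ (Fin n) → EuclideanSpace ℝ (Fin n) → ℝ}
    (hΩ : IsOpen Ω) (hb : Bornology.IsBounded Ω) (hG : IsGreenFunction Ω G)
    (hG' : IsGreenFunction Ω G') (hy : y ∈ Ω) (hx : x ∈ Ω) (hxy : x ≠ y) : G x y = G' x y := by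
  have hi : ∀ {G : EuclideanSpace ℝ (Fin n) → EuclideanSpace ℝ (Fin n) → ℝ}, IsGreenFunction Ω G →
      ∀ φ : EuclideanSpace ℝ (Fin n) → ℝ, ContDiff ℝ ∞ φ → HasCompactSupport φ → tsupport φ ⊆ Ω →
      IntegrableOn (fun x => G x y * (Δ φ) x) Ω := by
    intro G hG φ hφ hc hs
    have h1 : IntegrableOn (fun x => G x y * (Δ φ) x) (tsupport φ) :=
      ((hG.locallyIntegrableOn y hy).integrableOn_compact_subset hs hc).mul_continuousOn
        (contDiff_laplacian_continuous (contDiff_infty.1 hφ 2)).continuousOn hc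
    refine h1.of_forall_sdiff_eq_zero hΩ.measurableSet fun z hz => ?_
    have : (Δ φ) z = 0 := by
      by_contra h0
      exact hz.2 (tsupport_laplacian_subset φ (subset_tsupport _ h0))
    simp [this]
  refine sub_eq_zero.1 (eq_zero_of_distributional_harmonic (u := fun x => G x y - G' x y) hn hΩ hb
    hy ((hG.locallyIntegrableOn y hy).sub (hG'.locallyIntegrableOn y hy)) (fun φ hφ hc hs => ?_)
    ((hG.continuousOn y hy).sub (hG'.continuousOn y hy)) (fun z hz => ?_) hx hxy)
  · have h1 := hG.neg_laplacian_eq_dirac y hy φ hφ hc hs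
    have h2 := hG'.neg_laplacian_eq_dirac y hy φ hφ hc hs
    simp only [mul_neg, integral_neg] at h1 h2
    simp only [sub_mul]
    rw [integral_sub (hi hG φ hφ hc hs) (hi hG' φ hφ hc hs)]
    linarith
  · simp [hG.eq_zero_of_mem_frontier y hy z hz, hG'.eq_zero_of_mem_frontier y hy z hz]

/-- The chosen Green function agrees with the explicit one off the diagonal, which is all the
punctured limit sees; the explicit regular part is continuous at y. -/
theorem tendsto_regularPart (hn : 2 ≤ n) (ha0 : 0 < a) (ha1 : a < 1) (hy : y ∈ annulus n a) :
    Tendsto (fun x => regularPart (annulus n a) x y) (𝓝[≠] y) (𝓝 (annulusRegular n a y y)) := by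
  have hc : ContinuousAt (fun x => annulusRegular n a x y) y :=
    (continuousOn_annulusRegular hn ha0 ha1 hy).continuousAt
      (mem_of_superset ((isOpen_annulus n a).mem_nhds hy) fun x hx => ⟨hx.1.le, hx.2.le⟩)
  refine (hc.tendsto.mono_left nhdsWithin_le_nhds).congr' ?_
  filter_upwards [self_mem_nhdsWithin, nhdsWithin_le_nhds ((isOpen_annulus n a).mem_nhds hy)]
    with x hxy hx
  rw [regularPart, (isGreenFunction_greenFunction hn ha0 ha1).eq_of_ne hn (isOpen_annulus n a)
    (isBounded_annulus n a) (isGreenFunction_annulusGreen hn ha0 ha1) hy hx hxy, annulusGreen]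
  ring

theorem robinFunction_annulus (hn : 2 ≤ n) (ha0 : 0 < a) (ha1 : a < 1) (hy : y ∈ annulus n a) :
    robinFunction (annulus n a) y = annulusRegular n a y y := by
  have := nontrivial_euclidean hn
  have : NeBot (𝓝[≠] y) := Module.punctured_nhds_neBot ℝ (EuclideanSpace ℝ (Fin n)) y
  exact (tendsto_regularPart hn ha0 ha1 hy).limUnder_eq

end Annulus

/-! ### The Robin function as a radial series. -/

/-- The value on the diagonal of the image potential with parameter `q`, at distance `r`. -/
noncomputable def diagTerm (n : ℕ) (q r : ℝ) : ℝ :=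
  2 * radialKernel n ((1 - q) * r) - radialKernel n (r ^ 2 - q) - radialKernel n (1 - q * r ^ 2)

/-- The radial profile of the Robin function of the annulus. -/
noncomputable def robinProfile (n : ℕ) (a r : ℝ) : ℝ :=
  (∑' k : ℕ, a ^ ((n - 2) * (k + 1)) * diagTerm n (a ^ (2 * (k + 1))) r) -
    radialKernel n (1 - r ^ 2) - (if n = 2 then Real.log r / Real.log a else 0) * radialKernel n r

/-- `ω r` times the derivative of `diagTerm (m + 2) q`. -/
noncomputable def diagFlux (m : ℕ) (q r : ℝ) : ℝ :=
  -2 * (((1 - q) * r) ^ m)⁻¹ + 2 * r ^ 2 * ((r ^ 2 - q) ^ (m + 1))⁻¹ -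
    2 * q * r ^ 2 * ((1 - q * r ^ 2) ^ (m + 1))⁻¹

/-- The derivative of `diagFlux m q`. -/
noncomputable def diagFluxDeriv (m : ℕ) (q r : ℝ) : ℝ :=
  2 * m * (((1 - q) ^ m) * r ^ (m + 1))⁻¹ - 4 * r * (m * r ^ 2 + q) * ((r ^ 2 - q) ^ (m + 2))⁻¹ -
    4 * q * r * (1 + m * (q * r ^ 2)) * ((1 - q * r ^ 2) ^ (m + 2))⁻¹

section Profile

variable {n : ℕ} {a : ℝ} {y : EuclideanSpace ℝ (Fin n)}

lemma imageTerm_self (ha0 : 0 < a) (hy : y ∈ annulus n a) {q : ℝ}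
    (hq1 : q ≤ 1) (hqy : q ≤ ‖y‖ ^ 2) : imageTerm n q y y = diagTerm n q ‖y‖ := by
  have hy0 : 0 < ‖y‖ := ha0.trans hy.1
  have h : ∀ α β : ℝ, imageKernel n α β y y = radialKernel n (|α - β| * ‖y‖) := by
    intro α β
    rw [imageKernel, ← sub_smul, norm_smul, Real.norm_eq_abs]
  have hy2 : q * ‖y‖ ^ 2 ≤ 1 := mul_le_one₀ hq1 (by positivity) (pow_le_one₀ hy0.le hy.2.le)
  have habs : ∀ t : ℝ, |t| * ‖y‖ = |t * ‖y‖| := fun t => by rw [abs_mul, abs_norm]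
  have e3 : |‖y‖ - q / ‖y‖| * ‖y‖ = ‖y‖ ^ 2 - q := by
    rw [habs, sub_mul, div_mul_cancel₀ _ hy0.ne',
      ← sq, abs_of_nonneg (by linarith)]
  have e4 : |q * ‖y‖ - ‖y‖⁻¹| * ‖y‖ = 1 - q * ‖y‖ ^ 2 := by
    rw [habs, sub_mul, inv_mul_cancel₀ hy0.ne',
      mul_assoc, ← sq, abs_of_nonpos (by linarith)]
    ring
  rw [imageTerm, h, h, h, h, e3, e4, abs_of_nonneg (by linarith), abs_of_nonpos (by linarith),
    diagTerm, neg_sub]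
  ring

lemma ratio_le_norm_sq (ha0 : 0 < a) (ha1 : a < 1) (hy : y ∈ annulus n a) (k : ℕ) :
    a ^ (2 * (k + 1)) ≤ ‖y‖ ^ 2 :=
  (image_ratio_pow_le ha0 ha1 k).trans (pow_le_pow_left₀ ha0.le hy.1.le 2)

lemma annulusRegular_self (ha0 : 0 < a) (ha1 : a < 1) (hy : y ∈ annulus n a) :
    annulusRegular n a y y = robinProfile n a ‖y‖ := by
  have hy0 : 0 < ‖y‖ := ha0.trans hy.1
  have h2 : imageKernel n ‖y‖ ‖y‖⁻¹ y y = radialKernel n (1 - ‖y‖ ^ 2) := by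
    rw [imageKernel, ← sub_smul, norm_smul, Real.norm_eq_abs]
    have hlt : ‖y‖ ^ 2 ≤ 1 := pow_le_one₀ hy0.le hy.2.le
    rw [show ∀ t : ℝ, |t| * ‖y‖ = |t * ‖y‖| from fun t => by rw [abs_mul, abs_norm], sub_mul,
      inv_mul_cancel₀ hy0.ne', ← sq, abs_of_nonpos (by linarith), neg_sub]
  simp only [annulusRegular, robinProfile, h2]
  congr 3
  funext k
  rw [imageTerm_self ha0 hy (pow_le_one₀ ha0.le ha1.le)
    (ratio_le_norm_sq ha0 ha1 hy k)]

/-- A vector of norm r realizes the scalar series as an image series on the diagonal, whose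
summability is known. -/
lemma summable_diagTerm (hn : 2 ≤ n) (ha0 : 0 < a) (ha1 : a < 1) {r : ℝ} (hr : r ∈ Set.Ioo a 1) :
    Summable fun k : ℕ => a ^ ((n - 2) * (k + 1)) * diagTerm n (a ^ (2 * (k + 1))) r := by
  have := nontrivial_euclidean hn
  obtain ⟨y, hy⟩ := exists_norm_eq (EuclideanSpace ℝ (Fin n)) (ha0.trans hr.1).le
  subst hy
  have hy : y ∈ annulus n a := hr
  refine (summable_image_term hn ha0 ha1 hy ⟨hr.1.le, hr.2.le⟩).congr fun k => ?_
  rw [imageTerm_self ha0 hy (pow_le_one₀ ha0.le ha1.le)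
    (ratio_le_norm_sq ha0 ha1 hy k)]

end Profile

/-! ### Flux of a single image term. -/

section Derivatives

variable {m : ℕ} {q r : ℝ}

lemma hasDerivAt_pow_inv (m : ℕ) (hr : r ≠ 0) :
    HasDerivAt (fun r : ℝ => (r ^ m)⁻¹) (-m * (r ^ (m + 1))⁻¹) r := by
  refine ((hasDerivAt_pow m r).fun_inv (pow_ne_zero _ hr)).congr_deriv ?_
  cases m with
  | zero => simp
  | succ m =>
    simp only [Nat.add_sub_cancel]
    field_simp
    ring

lemma hasDerivAt_diagTerm (hq1 : q < 1) (hr0 : 0 < r) (hqr : q < r ^ 2) (hqr1 : q * r ^ 2 < 1) :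
    HasDerivAt (diagTerm (m + 2) q) ((sphereArea (m + 2) * r)⁻¹ * diagFlux m q r) r := by
  have hn : 2 ≤ m + 2 := by omega
  have hω := sphereArea_pos hn
  have hq1' : 0 < 1 - q := by linarith
  have hqr' : 0 < r ^ 2 - q := by linarith
  have hqr1' : 0 < 1 - q * r ^ 2 := by linarith
  have h1 : HasDerivAt (fun r => (1 - q) * r) (1 - q) r := by
    simpa using (hasDerivAt_id r).const_mul (1 - q)
  have h2 : HasDerivAt (fun r => r ^ 2 - q) (2 * r) r := by
    simpa using (hasDerivAt_pow 2 r).sub_const q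
  have h3 : HasDerivAt (fun r => 1 - q * r ^ 2) (-(q * (2 * r))) r := by
    simpa using ((hasDerivAt_pow 2 r).const_mul q).const_sub 1
  have k1 := (hasDerivAt_radialKernel hn (mul_pos hq1' hr0)).comp r h1
  have k2 := (hasDerivAt_radialKernel hn hqr').comp r h2
  have k3 := (hasDerivAt_radialKernel hn hqr1').comp r h3
  refine (((k1.const_mul 2).sub k2).sub k3).congr_deriv ?_
  simp only [diagFlux, show m + 2 - 1 = m + 1 by omega]
  rw [mul_pow (1 - q) r (m + 1), mul_pow (1 - q) r m]
  generalize r ^ 2 - q = A at *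
  generalize 1 - q * r ^ 2 = B at *
  generalize 1 - q = D at *
  field_simp
  ring

lemma hasDerivAt_diagFlux (hq1 : q < 1) (hr0 : 0 < r) (hqr : q < r ^ 2) (hqr1 : q * r ^ 2 < 1) :
    HasDerivAt (diagFlux m q) (diagFluxDeriv m q r) r := by
  have hq1' : 1 - q ≠ 0 := by linarith
  have hqr' : r ^ 2 - q ≠ 0 := by linarith
  have hqr1' : 1 - q * r ^ 2 ≠ 0 := by linarith
  have h1 : HasDerivAt (fun r => (1 - q) * r) (1 - q) r := by
    simpa using (hasDerivAt_id r).const_mul (1 - q)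
  have h2 : HasDerivAt (fun r => r ^ 2 - q) (2 * r) r := by
    simpa using (hasDerivAt_pow 2 r).sub_const q
  have h3 : HasDerivAt (fun r => 1 - q * r ^ 2) (-(q * (2 * r))) r := by
    simpa using ((hasDerivAt_pow 2 r).const_mul q).const_sub 1
  have k1 := (hasDerivAt_pow_inv m (mul_ne_zero hq1' hr0.ne')).comp r h1
  have k2 := (hasDerivAt_pow_inv (m + 1) hqr').comp r h2
  have k3 := (hasDerivAt_pow_inv (m + 1) hqr1').comp r h3
  have p1 : HasDerivAt (fun r : ℝ => 2 * r ^ 2) (2 * (2 * r)) r := by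
    simpa using (hasDerivAt_pow 2 r).const_mul 2
  have p2 : HasDerivAt (fun r : ℝ => 2 * q * r ^ 2) (2 * q * (2 * r)) r := by
    simpa using (hasDerivAt_pow 2 r).const_mul (2 * q)
  refine (((k1.const_mul (-2)).add (p1.mul k2)).sub (p2.mul k3)).congr_deriv ?_
  simp only [diagFluxDeriv, Function.comp_def]
  have t1 : -2 * (-(m : ℝ) * (((1 - q) * r) ^ (m + 1))⁻¹ * (1 - q)) =
      2 * m * (((1 - q) ^ m) * r ^ (m + 1))⁻¹ := by
    rw [mul_pow]
    field_simp
    ring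
  have t2 : 2 * (2 * r) * ((r ^ 2 - q) ^ (m + 1))⁻¹ + 2 * r ^ 2 *
      (-((m + 1 : ℕ) : ℝ) * ((r ^ 2 - q) ^ (m + 1 + 1))⁻¹ * (2 * r)) =
      -(4 * r * (m * r ^ 2 + q) * ((r ^ 2 - q) ^ (m + 2))⁻¹) := by
    push_cast
    field_simp
    ring
  have t3 : 2 * q * (2 * r) * ((1 - q * r ^ 2) ^ (m + 1))⁻¹ + 2 * q * r ^ 2 *
      (-((m + 1 : ℕ) : ℝ) * ((1 - q * r ^ 2) ^ (m + 1 + 1))⁻¹ * -(q * (2 * r))) =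
      4 * q * r * (1 + m * (q * r ^ 2)) * ((1 - q * r ^ 2) ^ (m + 2))⁻¹ := by
    push_cast
    field_simp
    ring
  rw [t1, t2, t3]
  ring

/-- Only the contribution of the charges qy and y/q can be positive. The image qy/|y|² dominates it,
because r² - q is at most both (1 - q)r and r²; its leftover part, proportional to q, makes the sign
strict. -/
lemma diagFluxDeriv_neg (hq0 : 0 < q) (hr0 : 0 < r) (hr1 : r < 1) (hqr : q < r ^ 2) :
    diagFluxDeriv m q r < 0 := by
  have hr2 : r ^ 2 < 1 := pow_lt_one₀ hr0.le hr1 (by norm_num)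
  have hq1 : 0 < 1 - q := by linarith
  have hA : 0 < r ^ 2 - q := by linarith
  have hB : 0 < 1 - q * r ^ 2 := by nlinarith
  -- The difference of the two sides is (1 - r)(r + q).
  have key : r ^ 2 - q ≤ (1 - q) * r := by nlinarith
  have h1 : (r ^ 2 - q) ^ (m + 2) ≤ ((1 - q) * r) ^ m * (r ^ 2) ^ 2 := by
    rw [pow_add]
    gcongr
    linarith
  have h2 : 2 * m * (((1 - q) ^ m) * r ^ (m + 1))⁻¹ ≤
      4 * r * (m * r ^ 2) * ((r ^ 2 - q) ^ (m + 2))⁻¹ := by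
    rw [← div_eq_mul_inv, ← div_eq_mul_inv, div_le_div_iff₀ (by positivity) (by positivity)]
    calc 2 * (m : ℝ) * (r ^ 2 - q) ^ (m + 2) ≤ 4 * m * (((1 - q) * r) ^ m * (r ^ 2) ^ 2) := by
          gcongr
          norm_num
      _ = _ := by rw [mul_pow]; ring
  have h3 : 0 < 4 * r * q * ((r ^ 2 - q) ^ (m + 2))⁻¹ := by positivity
  have h4 : 0 < 4 * q * r * (1 + m * (q * r ^ 2)) * ((1 - q * r ^ 2) ^ (m + 2))⁻¹ := by positivity
  have h5 : 4 * r * (m * r ^ 2 + q) * ((r ^ 2 - q) ^ (m + 2))⁻¹ =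
    4 * r * (m * r ^ 2) * ((r ^ 2 - q) ^ (m + 2))⁻¹ + 4 * r * q * ((r ^ 2 - q) ^ (m + 2))⁻¹ := by ring
  rw [diagFluxDeriv, h5]
  linarith

lemma inv_pow_le_inv_pow {e s : ℝ} {j N : ℕ} (he0 : 0 < e) (he1 : e ≤ 1) (hs : e ≤ s) (hj : j ≤ N) :
    (s ^ j)⁻¹ ≤ (e ^ N)⁻¹ := by
  have : e ^ N ≤ s ^ j := (pow_le_pow_of_le_one he0.le he1 hj).trans (pow_le_pow_left₀ he0.le hs j)
  gcongr

/-- The factor m + q serves both regimes: for m = 0 the constant parts cancel and the flux is O(q),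
while for m ≥ 1 boundedness suffices. The exponent 2m + 3 is a generous common bound that also
covers the denominators of the derivative. -/
lemma abs_diagFlux_le {e : ℝ} (he0 : 0 < e) (he1 : e ≤ 1) (hq0 : 0 ≤ q) (hr0 : 0 < r) (hr1 : r ≤ 1)
    (h1 : e ≤ (1 - q) * r) (h2 : e ≤ r ^ 2 - q) (h3 : e ≤ 1 - q * r ^ 2) :
    |diagFlux m q r| ≤ 6 * (e ^ (2 * m + 3))⁻¹ * (m + q) := by
  have hr2 : r ^ 2 ≤ 1 := pow_le_one₀ hr0.le hr1
  have hq1 : q ≤ 1 := by linarith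
  set E := (e ^ (2 * m + 3))⁻¹
  have hE : 0 < E := by positivity
  have s1 : 0 < (1 - q) * r := by linarith
  have s2 : 0 < r ^ 2 - q := by linarith
  have s3 : 0 < 1 - q * r ^ 2 := by linarith
  have b3 : ((1 - q * r ^ 2) ^ (m + 1))⁻¹ ≤ E := inv_pow_le_inv_pow he0 he1 h3 (by omega)
  have b2 : ((r ^ 2 - q) ^ (m + 1))⁻¹ ≤ E := inv_pow_le_inv_pow he0 he1 h2 (by omega)
  have b1 : (((1 - q) * r) ^ m)⁻¹ ≤ E := inv_pow_le_inv_pow he0 he1 h1 (by omega)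
  have p1 : 0 < (((1 - q) * r) ^ m)⁻¹ := by positivity
  have p2 : 0 < ((r ^ 2 - q) ^ (m + 1))⁻¹ := by positivity
  have p3 : 0 < ((1 - q * r ^ 2) ^ (m + 1))⁻¹ := by positivity
  have c3 : 2 * q * r ^ 2 * ((1 - q * r ^ 2) ^ (m + 1))⁻¹ ≤ 2 * q * 1 * E := by gcongr
  have d3 : 0 ≤ 2 * q * r ^ 2 * ((1 - q * r ^ 2) ^ (m + 1))⁻¹ := by positivity
  rcases Nat.eq_zero_or_pos m with rfl | hm
  · have e1 : -2 * (((1 - q) * r) ^ 0)⁻¹ + 2 * r ^ 2 * ((r ^ 2 - q) ^ (0 + 1))⁻¹ =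
        2 * q * ((r ^ 2 - q) ^ (0 + 1))⁻¹ := by
      field_simp
      ring
    have c2 : 2 * q * ((r ^ 2 - q) ^ (0 + 1))⁻¹ ≤ 2 * q * E := by gcongr
    have d2 : 0 ≤ 2 * q * ((r ^ 2 - q) ^ (0 + 1))⁻¹ := by positivity
    have : 0 ≤ E * q := by positivity
    rw [diagFlux, e1, abs_le]
    push_cast
    constructor <;> linarith
  · have hm1 : (1 : ℝ) ≤ m := by exact_mod_cast hm
    have c2 : 2 * r ^ 2 * ((r ^ 2 - q) ^ (m + 1))⁻¹ ≤ 2 * 1 * E := by gcongr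
    have d2 : 0 ≤ 2 * r ^ 2 * ((r ^ 2 - q) ^ (m + 1))⁻¹ := by positivity
    have : 0 ≤ E * q := by positivity
    have : E * 1 ≤ E * m := by gcongr
    rw [diagFlux, abs_le]
    constructor <;> linarith

lemma abs_diagFluxDeriv_le {e : ℝ} (he0 : 0 < e) (he1 : e ≤ 1) (hq0 : 0 ≤ q) (hr0 : 0 < r)
    (hr1 : r ≤ 1) (h1 : e ≤ (1 - q) * r) (h2 : e ≤ r ^ 2 - q) (h3 : e ≤ 1 - q * r ^ 2) :
    |diagFluxDeriv m q r| ≤ (8 + 4 * m) * (e ^ (2 * m + 3))⁻¹ * (m + q) := by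
  have hr2 : r ^ 2 ≤ 1 := pow_le_one₀ hr0.le hr1
  have hq1 : q ≤ 1 := by linarith
  set E := (e ^ (2 * m + 3))⁻¹
  have hE : 0 < E := by positivity
  have hq : e ≤ 1 - q := h1.trans (mul_le_of_le_one_right (by linarith) hr1)
  have hr : e ≤ r := h1.trans (mul_le_of_le_one_left hr0.le (by linarith))
  have s1 : 0 < 1 - q := by linarith
  have s2 : 0 < r ^ 2 - q := by linarith
  have s3 : 0 < 1 - q * r ^ 2 := by linarith
  have b3 : ((1 - q * r ^ 2) ^ (m + 2))⁻¹ ≤ E := inv_pow_le_inv_pow he0 he1 h3 (by omega)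
  have b2 : ((r ^ 2 - q) ^ (m + 2))⁻¹ ≤ E := inv_pow_le_inv_pow he0 he1 h2 (by omega)
  have b1 : ((1 - q) ^ m * r ^ (m + 1))⁻¹ ≤ E := by
    have h4 : e ^ (2 * m + 3) ≤ (1 - q) ^ m * r ^ (m + 1) := by
      calc e ^ (2 * m + 3) ≤ e ^ (m + (m + 1)) := pow_le_pow_of_le_one he0.le he1 (by omega)
        _ = e ^ m * e ^ (m + 1) := pow_add _ _ _
        _ ≤ _ := by gcongr
    have : 0 < e ^ (2 * m + 3) := by positivity
    exact inv_anti₀ this h4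
  have c1 : 2 * m * ((1 - q) ^ m * r ^ (m + 1))⁻¹ ≤ 2 * m * E := by gcongr
  have d1 : 0 ≤ 2 * m * ((1 - q) ^ m * r ^ (m + 1))⁻¹ := by positivity
  have c2 : 4 * r * (m * r ^ 2 + q) * ((r ^ 2 - q) ^ (m + 2))⁻¹ ≤ 4 * 1 * (m * 1 + q) * E := by
    gcongr
  have d2 : 0 ≤ 4 * r * (m * r ^ 2 + q) * ((r ^ 2 - q) ^ (m + 2))⁻¹ := by positivity
  have c3 : 4 * q * r * (1 + m * (q * r ^ 2)) * ((1 - q * r ^ 2) ^ (m + 2))⁻¹ ≤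
      4 * q * 1 * (1 + m * (1 * 1)) * E := by gcongr
  have d3 : 0 ≤ 4 * q * r * (1 + m * (q * r ^ 2)) * ((1 - q * r ^ 2) ^ (m + 2))⁻¹ := by positivity
  have f1 : 0 ≤ (m : ℝ) * E := by positivity
  have f2 : 0 ≤ (m : ℝ) ^ 2 * E := by positivity
  have f3 : 0 ≤ (m : ℝ) * q * E := by positivity
  rw [diagFluxDeriv, abs_le]
  constructor <;> nlinarith

end Derivatives

/-! ### Termwise differentiation, monotonicity and endpoint limits. -/

section Series

variable {m : ℕ} {a : ℝ}

/-- `ω r R'(r)` for the profile `R` of the Robin function. -/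
noncomputable def robinFlux (m : ℕ) (a r : ℝ) : ℝ :=
  (∑' k : ℕ, a ^ (m * (k + 1)) * diagFlux m (a ^ (2 * (k + 1))) r) -
    2 * r ^ 2 * ((1 - r ^ 2) ^ (m + 1))⁻¹ + (if m = 0 then 2 * (Real.log r / Real.log a) else 0)

/-- The derivative of `robinFlux`. -/
noncomputable def robinFluxDeriv (m : ℕ) (a r : ℝ) : ℝ :=
  (∑' k : ℕ, a ^ (m * (k + 1)) * diagFluxDeriv m (a ^ (2 * (k + 1))) r) -
    4 * r * (1 + m * r ^ 2) * ((1 - r ^ 2) ^ (m + 2))⁻¹ +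
    (if m = 0 then 2 * (r⁻¹ / Real.log a) else 0)

/-- For m = 0 the decay comes from q, for m ≥ 1 from the weight. -/
lemma weight_mul_le (ha0 : 0 < a) (ha1 : a < 1) (k : ℕ) :
    a ^ (m * (k + 1)) * (m + a ^ (2 * (k + 1))) ≤ (m + 1) * a ^ k := by
  have hq : a ^ (2 * (k + 1)) ≤ a ^ k := pow_le_pow_of_le_one ha0.le ha1.le (by omega)
  rcases Nat.eq_zero_or_pos m with rfl | hm
  · simpa using hq
  · have h1 : a ^ (m * (k + 1)) ≤ a ^ k := by
      refine pow_le_pow_of_le_one ha0.le ha1.le ?_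
      have : 1 * (k + 1) ≤ m * (k + 1) := Nat.mul_le_mul_right _ hm
      omega
    have h2 : a ^ (2 * (k + 1)) ≤ 1 := pow_le_one₀ ha0.le ha1.le
    calc a ^ (m * (k + 1)) * (m + a ^ (2 * (k + 1))) ≤ a ^ k * (m + 1) := by gcongr
      _ = _ := by ring

lemma ratio_bounds (ha0 : 0 < a) (ha1 : a < 1) {r : ℝ} (hr : r ∈ Set.Ioo a 1) (k : ℕ) :
    0 < a ^ (2 * (k + 1)) ∧ a ^ (2 * (k + 1)) < 1 ∧ a ^ (2 * (k + 1)) < r ^ 2 ∧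
      a ^ (2 * (k + 1)) * r ^ 2 < 1 := by
  have hr0 := ha0.trans hr.1
  have h0 := image_ratio_pow_pos ha0 k
  have h1 := image_ratio_pow_le ha0 ha1 k
  have h2 : a ^ 2 < r ^ 2 := by gcongr; exact hr.1
  have h3 : r ^ 2 < 1 := pow_lt_one₀ hr0.le hr.2 (by norm_num)
  refine ⟨h0, by linarith, by linarith, ?_⟩
  have : a ^ (2 * (k + 1)) * r ^ 2 ≤ 1 * r ^ 2 := by gcongr; linarith
  linarith

/-- Uniform lower bounds for the denominators on `(b, 1)`. -/
lemma denominator_bounds (ha0 : 0 < a) (ha1 : a < 1) {b r : ℝ} (hb : b ∈ Set.Ioo a 1)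
    (hr : r ∈ Set.Ioo b 1) (k : ℕ) :
    b ^ 2 - a ^ 2 ≤ r ∧
    b ^ 2 - a ^ 2 ≤ (1 - a ^ (2 * (k + 1))) * r ∧ b ^ 2 - a ^ 2 ≤ r ^ 2 - a ^ (2 * (k + 1)) ∧
      b ^ 2 - a ^ 2 ≤ 1 - a ^ (2 * (k + 1)) * r ^ 2 := by
  have h0 := image_ratio_pow_pos ha0 k
  have h1 := image_ratio_pow_le ha0 ha1 k
  have hb0 := ha0.trans hb.1
  have hr0 := hb0.trans hr.1
  have h2 : b ^ 2 ≤ r ^ 2 := by gcongr; exact hr.1.le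
  have h3 : r ^ 2 ≤ r := by rw [sq]; exact mul_le_of_le_one_left hr0.le hr.2.le
  have h4 : r ≤ 1 := hr.2.le
  have h5 : a ^ (2 * (k + 1)) * r ^ 2 ≤ a ^ 2 * 1 := by gcongr; linarith
  have h6 : a ^ (2 * (k + 1)) * r ≤ a ^ 2 * 1 := by gcongr
  have h7 : 0 ≤ a ^ 2 := by positivity
  refine ⟨?_, ?_, ?_, ?_⟩ <;> linarith

/-- Uniformity requires b > a, since r² - a² in the first term degenerates at r = a. Nothing in the
series degenerates at r = 1, because the image y/|y|² is kept outside it. -/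
lemma exists_flux_bound (m : ℕ) (ha0 : 0 < a) (ha1 : a < 1) {b : ℝ} (hb : b ∈ Set.Ioo a 1) :
    ∃ C, ∀ (k : ℕ), ∀ r ∈ Set.Ioo b 1,
      ‖a ^ (m * (k + 1)) * diagFlux m (a ^ (2 * (k + 1))) r‖ ≤ C * a ^ k ∧
      ‖a ^ (m * (k + 1)) * diagFluxDeriv m (a ^ (2 * (k + 1))) r‖ ≤ C * a ^ k := by
  set e := b ^ 2 - a ^ 2
  have he0 : 0 < e := sub_pos.2 (by gcongr; exact hb.1)
  refine ⟨(8 + 4 * m) * (e ^ (2 * m + 3))⁻¹ * (m + 1), fun k r hr => ?_⟩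
  have hr0 : 0 < r := ha0.trans (hb.1.trans hr.1)
  obtain ⟨e1, e2, e3, e4⟩ := denominator_bounds ha0 ha1 hb hr k
  have he1 : e ≤ 1 := e1.trans hr.2.le
  have h0 := image_ratio_pow_pos ha0 k
  have h5 := abs_diagFlux_le (m := m) he0 he1 h0.le hr0 hr.2.le e2 e3 e4
  have h6 := abs_diagFluxDeriv_le (m := m) he0 he1 h0.le hr0 hr.2.le e2 e3 e4
  have h7 : 6 * (e ^ (2 * m + 3))⁻¹ * (m + a ^ (2 * (k + 1))) ≤
      (8 + 4 * m) * (e ^ (2 * m + 3))⁻¹ * (m + a ^ (2 * (k + 1))) := by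
    gcongr
    have : (0 : ℝ) ≤ m := Nat.cast_nonneg m
    linarith
  have hw : 0 < a ^ (m * (k + 1)) := by positivity
  have key : ∀ t : ℝ, |t| ≤ (8 + 4 * m) * (e ^ (2 * m + 3))⁻¹ * (m + a ^ (2 * (k + 1))) →
      ‖a ^ (m * (k + 1)) * t‖ ≤ (8 + 4 * m) * (e ^ (2 * m + 3))⁻¹ * (m + 1) * a ^ k := by
    intro t ht
    rw [norm_mul, Real.norm_of_nonneg hw.le, Real.norm_eq_abs]
    calc a ^ (m * (k + 1)) * |t|
        ≤ a ^ (m * (k + 1)) * ((8 + 4 * m) * (e ^ (2 * m + 3))⁻¹ * (m + a ^ (2 * (k + 1)))) := by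
          gcongr
      _ = (8 + 4 * m) * (e ^ (2 * m + 3))⁻¹ * (a ^ (m * (k + 1)) * (m + a ^ (2 * (k + 1)))) := by
          ring
      _ ≤ (8 + 4 * m) * (e ^ (2 * m + 3))⁻¹ * ((m + 1) * a ^ k) :=
          mul_le_mul_of_nonneg_left (weight_mul_le ha0 ha1 k) (by positivity)
      _ = _ := by ring
  exact ⟨key _ (h5.trans h7), key _ h6⟩

lemma exists_mem_Ioo_subset {r : ℝ} (hr : r ∈ Set.Ioo a 1) :
    ∃ b ∈ Set.Ioo a 1, r ∈ Set.Ioo b 1 :=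
  ⟨(a + r) / 2, ⟨by linarith [hr.1], by linarith [hr.1, hr.2]⟩, ⟨by linarith [hr.1], hr.2⟩⟩

lemma summable_flux (ha0 : 0 < a) (ha1 : a < 1) {r : ℝ} (hr : r ∈ Set.Ioo a 1) :
    Summable fun k : ℕ => a ^ (m * (k + 1)) * diagFlux m (a ^ (2 * (k + 1))) r := by
  obtain ⟨b, hb, hrb⟩ := exists_mem_Ioo_subset hr
  obtain ⟨C, hC⟩ := exists_flux_bound m ha0 ha1 hb
  exact Summable.of_norm_bounded (summable_const_mul_pow ha0 ha1 C) fun k => (hC k r hrb).1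

lemma hasDerivAt_weight_mul_diagFlux (ha0 : 0 < a) (ha1 : a < 1) {r : ℝ} (hr : r ∈ Set.Ioo a 1)
    (k : ℕ) : HasDerivAt (fun r => a ^ (m * (k + 1)) * diagFlux m (a ^ (2 * (k + 1))) r)
      (a ^ (m * (k + 1)) * diagFluxDeriv m (a ^ (2 * (k + 1))) r) r := by
  obtain ⟨-, h1, h2, h3⟩ := ratio_bounds ha0 ha1 hr k
  exact (hasDerivAt_diagFlux h1 (ha0.trans hr.1) h2 h3).const_mul _

lemma hasDerivAt_tsum_flux (ha0 : 0 < a) (ha1 : a < 1) {r : ℝ} (hr : r ∈ Set.Ioo a 1) :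
    HasDerivAt (fun r => ∑' k : ℕ, a ^ (m * (k + 1)) * diagFlux m (a ^ (2 * (k + 1))) r)
      (∑' k : ℕ, a ^ (m * (k + 1)) * diagFluxDeriv m (a ^ (2 * (k + 1))) r) r := by
  obtain ⟨b, hb, hrb⟩ := exists_mem_Ioo_subset hr
  obtain ⟨C, hC⟩ := exists_flux_bound m ha0 ha1 hb
  exact hasDerivAt_tsum_of_isPreconnected (summable_const_mul_pow ha0 ha1 C) isOpen_Ioo
    isPreconnected_Ioo
    (fun k s hs => hasDerivAt_weight_mul_diagFlux ha0 ha1 ⟨hb.1.trans hs.1, hs.2⟩ k)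
    (fun k s hs => (hC k s hs).2) hrb (summable_flux ha0 ha1 hr) hrb

lemma hasDerivAt_tsum_diagTerm (ha0 : 0 < a) (ha1 : a < 1) {r : ℝ} (hr : r ∈ Set.Ioo a 1) :
    HasDerivAt (fun r => ∑' k : ℕ, a ^ (m * (k + 1)) * diagTerm (m + 2) (a ^ (2 * (k + 1))) r)
      ((sphereArea (m + 2) * r)⁻¹ *
        ∑' k : ℕ, a ^ (m * (k + 1)) * diagFlux m (a ^ (2 * (k + 1))) r) r := by
  obtain ⟨b, hb, hrb⟩ := exists_mem_Ioo_subset hr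
  obtain ⟨C, hC⟩ := exists_flux_bound m ha0 ha1 hb
  have hω := sphereArea_pos (show 2 ≤ m + 2 by omega)
  have hb0 : 0 < b := ha0.trans hb.1
  have h := hasDerivAt_tsum_of_isPreconnected
    (g := fun (k : ℕ) r => a ^ (m * (k + 1)) * diagTerm (m + 2) (a ^ (2 * (k + 1))) r)
    (g' := fun (k : ℕ) r => (sphereArea (m + 2) * r)⁻¹ *
      (a ^ (m * (k + 1)) * diagFlux m (a ^ (2 * (k + 1))) r))
    (u := fun k => (sphereArea (m + 2) * b)⁻¹ * (C * a ^ k)) (t := Set.Ioo b 1) (y₀ := r) (y := r)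
    ((summable_const_mul_pow ha0 ha1 C).mul_left _) isOpen_Ioo isPreconnected_Ioo
    (fun k s hs => ?_) (fun k s hs => ?_) hrb
    (summable_diagTerm (n := m + 2) (by omega) ha0 ha1 hr) hrb
  · rwa [tsum_mul_left] at h
  · have hs' : s ∈ Set.Ioo a 1 := ⟨hb.1.trans hs.1, hs.2⟩
    obtain ⟨-, h1, h2, h3⟩ := ratio_bounds ha0 ha1 hs' k
    refine ((hasDerivAt_diagTerm h1 (ha0.trans hs'.1) h2 h3).const_mul _).congr_deriv ?_
    ring
  · have hs0 : 0 < s := hb0.trans hs.1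
    rw [norm_mul, Real.norm_of_nonneg (by positivity)]
    have h1 := (hC k s hs).1
    have h2 : (sphereArea (m + 2) * s)⁻¹ ≤ (sphereArea (m + 2) * b)⁻¹ := by
      gcongr
      exact hs.1.le
    exact mul_le_mul h2 h1 (norm_nonneg _) (by positivity)

lemma hasDerivAt_robinProfile (ha0 : 0 < a) (ha1 : a < 1) {r : ℝ} (hr : r ∈ Set.Ioo a 1) :
    HasDerivAt (robinProfile (m + 2) a) ((sphereArea (m + 2) * r)⁻¹ * robinFlux m a r) r := by
  have hn : 2 ≤ m + 2 := by omega
  have hω := sphereArea_pos hn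
  have hr0 := ha0.trans hr.1
  have hr2 : 0 < 1 - r ^ 2 := sub_pos.2 (pow_lt_one₀ hr0.le hr.2 (by norm_num))
  have h1 := hasDerivAt_tsum_diagTerm (m := m) ha0 ha1 hr
  have h2 : HasDerivAt (fun r => radialKernel (m + 2) (1 - r ^ 2))
      ((sphereArea (m + 2) * r)⁻¹ * (2 * r ^ 2 * ((1 - r ^ 2) ^ (m + 1))⁻¹)) r := by
    have h3 : HasDerivAt (fun r : ℝ => 1 - r ^ 2) (-(2 * r)) r := by
      simpa using (hasDerivAt_pow 2 r).const_sub 1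
    refine ((hasDerivAt_radialKernel hn hr2).comp r h3).congr_deriv ?_
    rw [show m + 2 - 1 = m + 1 by omega]
    field_simp
  have h4 : HasDerivAt
      (fun r => (if m + 2 = 2 then Real.log r / Real.log a else 0) * radialKernel (m + 2) r)
      (-((sphereArea (m + 2) * r)⁻¹ * (if m = 0 then 2 * (Real.log r / Real.log a) else 0))) r := by
    rcases Nat.eq_zero_or_pos m with rfl | hm
    · have hla : Real.log a ≠ 0 := (Real.log_neg ha0 ha1).ne
      simp only [Nat.zero_add, if_true, radialKernel_two, sphereArea_two]
      have h5 := Real.hasDerivAt_log hr0.ne'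
      refine ((h5.div_const (Real.log a)).mul (h5.const_mul (-(1 / (2 * Real.pi))))).congr_deriv ?_
      field_simp
      ring
    · rw [if_neg hm.ne']
      simp only [show m + 2 ≠ 2 by omega, if_false, zero_mul, mul_zero, neg_zero]
      exact hasDerivAt_const _ _
  refine ((h1.sub h2).sub h4).congr_deriv ?_
  rw [robinFlux]
  ring

lemma hasDerivAt_robinFlux (ha0 : 0 < a) (ha1 : a < 1) {r : ℝ} (hr : r ∈ Set.Ioo a 1) :
    HasDerivAt (robinFlux m a) (robinFluxDeriv m a r) r := by
  have hr0 := ha0.trans hr.1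
  have hr2 : 0 < 1 - r ^ 2 := sub_pos.2 (pow_lt_one₀ hr0.le hr.2 (by norm_num))
  have h1 := hasDerivAt_tsum_flux (m := m) ha0 ha1 hr
  have h2 : HasDerivAt (fun r : ℝ => 2 * r ^ 2 * ((1 - r ^ 2) ^ (m + 1))⁻¹)
      (4 * r * (1 + m * r ^ 2) * ((1 - r ^ 2) ^ (m + 2))⁻¹) r := by
    have h3 : HasDerivAt (fun r : ℝ => 1 - r ^ 2) (-(2 * r)) r := by
      simpa using (hasDerivAt_pow 2 r).const_sub 1
    have p1 : HasDerivAt (fun r : ℝ => 2 * r ^ 2) (2 * (2 * r)) r := by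
      simpa using (hasDerivAt_pow 2 r).const_mul 2
    refine (p1.mul ((hasDerivAt_pow_inv (m + 1) hr2.ne').comp r h3)).congr_deriv ?_
    simp only [Function.comp_def]
    push_cast
    field_simp
    ring
  have h4 : HasDerivAt (fun r : ℝ => if m = 0 then 2 * (Real.log r / Real.log a) else 0)
      (if m = 0 then 2 * (r⁻¹ / Real.log a) else 0) r := by
    split_ifs
    · exact ((Real.hasDerivAt_log hr0.ne').div_const _).const_mul 2
    · exact hasDerivAt_const _ _
  exact (h1.sub h2).add h4

lemma robinFluxDeriv_neg (ha0 : 0 < a) (ha1 : a < 1) {r : ℝ} (hr : r ∈ Set.Ioo a 1) :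
    robinFluxDeriv m a r < 0 := by
  have hr0 := ha0.trans hr.1
  have hr2 : 0 < 1 - r ^ 2 := sub_pos.2 (pow_lt_one₀ hr0.le hr.2 (by norm_num))
  have h1 : ∑' k : ℕ, a ^ (m * (k + 1)) * diagFluxDeriv m (a ^ (2 * (k + 1))) r ≤ 0 := by
    refine tsum_nonpos fun k => ?_
    obtain ⟨h0, -, h2, -⟩ := ratio_bounds ha0 ha1 hr k
    exact mul_nonpos_of_nonneg_of_nonpos (by positivity) (diagFluxDeriv_neg h0 hr0 hr.2 h2).le
  have h2 : 0 < 4 * r * (1 + m * r ^ 2) * ((1 - r ^ 2) ^ (m + 2))⁻¹ := by positivity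
  have h3 : (if m = 0 then 2 * (r⁻¹ / Real.log a) else 0) ≤ 0 := by
    split_ifs
    · have : r⁻¹ / Real.log a ≤ 0 :=
        div_nonpos_of_nonneg_of_nonpos (by positivity) (Real.log_neg ha0 ha1).le
      linarith
    · exact le_rfl
  rw [robinFluxDeriv]
  linarith

lemma continuousOn_robinFluxDeriv (ha0 : 0 < a) (ha1 : a < 1) :
    ContinuousOn (robinFluxDeriv m a) (Set.Ioo a 1) := by
  intro r hr
  obtain ⟨b, hb, hrb⟩ := exists_mem_Ioo_subset hr
  obtain ⟨C, hC⟩ := exists_flux_bound m ha0 ha1 hb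
  have hr0 := ha0.trans hr.1
  have hr2 : 1 - r ^ 2 ≠ 0 := (sub_pos.2 (pow_lt_one₀ hr0.le hr.2 (by norm_num))).ne'
  have h1 : ContinuousOn (fun r => ∑' k : ℕ, a ^ (m * (k + 1)) *
      diagFluxDeriv m (a ^ (2 * (k + 1))) r) (Set.Ioo b 1) := by
    refine continuousOn_tsum (fun k s hs => ?_) (summable_const_mul_pow ha0 ha1 C)
      fun k s hs => (hC k s hs).2
    have hs0 : 0 < s := ha0.trans (hb.1.trans hs.1)
    obtain ⟨-, h1, h2, h3⟩ := ratio_bounds ha0 ha1 ⟨hb.1.trans hs.1, hs.2⟩ k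
    have e1 : (1 - a ^ (2 * (k + 1))) ^ m * s ^ (m + 1) ≠ 0 :=
      mul_ne_zero (pow_ne_zero _ (by linarith)) (pow_ne_zero _ hs0.ne')
    have e2 : (s ^ 2 - a ^ (2 * (k + 1))) ^ (m + 2) ≠ 0 := pow_ne_zero _ (by linarith)
    have e3 : (1 - a ^ (2 * (k + 1)) * s ^ 2) ^ (m + 2) ≠ 0 := pow_ne_zero _ (by linarith)
    refine ContinuousAt.continuousWithinAt ?_
    unfold diagFluxDeriv
    fun_prop (disch := assumption)
  have h2 : ContinuousAt (fun r : ℝ => 4 * r * (1 + m * r ^ 2) * ((1 - r ^ 2) ^ (m + 2))⁻¹) r := by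
    have e3 : (1 - r ^ 2) ^ (m + 2) ≠ 0 := pow_ne_zero _ hr2
    fun_prop (disch := assumption)
  have h3 : ContinuousAt (fun r : ℝ => if m = 0 then 2 * (r⁻¹ / Real.log a) else 0) r := by
    have := hr0.ne'
    split_ifs
    · exact ((continuousAt_inv₀ this).div_const _).const_mul 2
    · exact continuousAt_const
  exact (((h1.continuousAt (isOpen_Ioo.mem_nhds hrb)).sub h2).add h3).continuousWithinAt

lemma antitoneOn_diagFlux (ha0 : 0 < a) (ha1 : a < 1) (k : ℕ) :
    AntitoneOn (fun r => a ^ (m * (k + 1)) * diagFlux m (a ^ (2 * (k + 1))) r) (Set.Ioo a 1) := by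
  refine antitoneOn_of_deriv_nonpos (convex_Ioo a 1)
    (fun r hr => (hasDerivAt_weight_mul_diagFlux ha0 ha1 hr k).continuousAt.continuousWithinAt)
    (fun r hr => ?_) fun r hr => ?_
  · rw [interior_Ioo] at hr
    exact (hasDerivAt_weight_mul_diagFlux ha0 ha1 hr k).differentiableAt.differentiableWithinAt
  · rw [interior_Ioo] at hr
    rw [(hasDerivAt_weight_mul_diagFlux ha0 ha1 hr k).deriv]
    obtain ⟨h0, -, h2, -⟩ := ratio_bounds ha0 ha1 hr k
    exact mul_nonpos_of_nonneg_of_nonpos (by positivity)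
      (diagFluxDeriv_neg h0 (ha0.trans hr.1) hr.2 h2).le

lemma log_term_antitone (ha0 : 0 < a) (ha1 : a < 1) {r s : ℝ} (hr : 0 < r) (hrs : r ≤ s) :
    (if m = 0 then 2 * (Real.log s / Real.log a) else 0) ≤
      if m = 0 then 2 * (Real.log r / Real.log a) else 0 := by
  split_ifs
  · have := div_le_div_of_nonpos_of_le (Real.log_neg ha0 ha1).le (Real.log_le_log hr hrs)
    linarith
  · exact le_rfl

lemma tendsto_inv_pow_atTop {f : ℝ → ℝ} {l : Filter ℝ} (hf : Tendsto f l (𝓝[>] 0)) {N : ℕ}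
    (hN : N ≠ 0) : Tendsto (fun r => (f r ^ N)⁻¹) l atTop := by
  have h1 := tendsto_inv_nhdsGT_zero.comp hf
  simpa [Function.comp_def] using (tendsto_pow_atTop hN).comp h1

/-- By monotonicity the series and the logarithmic term are bounded above on (s, 1) by their values
at s, while the contribution of y/|y|² tends to -∞. -/
lemma tendsto_robinFlux_nhdsLT_one (ha0 : 0 < a) (ha1 : a < 1) :
    Tendsto (robinFlux m a) (𝓝[<] 1) atBot := by
  set s := (a + 1) / 2
  have hs : s ∈ Set.Ioo a 1 := ⟨by simp only [s]; linarith, by simp only [s]; linarith⟩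
  set C := (∑' k : ℕ, a ^ (m * (k + 1)) * diagFlux m (a ^ (2 * (k + 1))) s) +
    if m = 0 then 2 * (Real.log s / Real.log a) else 0
  have hev : Set.Ioo s 1 ∈ 𝓝[<] (1 : ℝ) := Ioo_mem_nhdsLT hs.2
  have hg : Tendsto (fun r : ℝ => 2 * r ^ 2 * ((1 - r ^ 2) ^ (m + 1))⁻¹) (𝓝[<] 1) atTop := by
    have h1 : Tendsto (fun r : ℝ => 1 - r ^ 2) (𝓝[<] 1) (𝓝[>] 0) := by
      refine tendsto_nhdsWithin_iff.2 ⟨?_, ?_⟩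
      · have h : Continuous fun r : ℝ => 1 - r ^ 2 := by fun_prop
        have h' := h.tendsto 1
        rw [show (1 : ℝ) - 1 ^ 2 = 0 by norm_num] at h'
        exact h'.mono_left nhdsWithin_le_nhds
      · filter_upwards [hev] with r hr
        have hr0 : 0 < r := ha0.trans (hs.1.trans hr.1)
        exact sub_pos.2 (pow_lt_one₀ hr0.le hr.2 (by norm_num))
    have h2 : Tendsto (fun r : ℝ => 2 * r ^ 2) (𝓝[<] 1) (𝓝 2) := by
      have h : Continuous fun r : ℝ => 2 * r ^ 2 := by fun_prop
      have h' := h.tendsto 1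
      rw [show (2 : ℝ) * 1 ^ 2 = 2 by norm_num] at h'
      exact h'.mono_left nhdsWithin_le_nhds
    exact h2.pos_mul_atTop two_pos (tendsto_inv_pow_atTop h1 (by omega))
  refine tendsto_atBot_mono' _ ?_ (tendsto_const_nhds (x := C) |>.add_atBot
    (tendsto_neg_atTop_atBot.comp hg))
  filter_upwards [hev] with r hr
  have hr' : r ∈ Set.Ioo a 1 := ⟨hs.1.trans hr.1, hr.2⟩
  have h1 := (summable_flux (m := m) ha0 ha1 hr').tsum_le_tsum
    (fun k => antitoneOn_diagFlux ha0 ha1 k hs hr' hr.1.le) (summable_flux (m := m) ha0 ha1 hs)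
  have h2 := log_term_antitone (m := m) ha0 ha1 (ha0.trans hs.1) hr.1.le
  simp only [robinFlux, Function.comp_def, C]
  linarith

/-- Only the term k = 0, with q = a², is singular at r = a, through 2r²/(r² - a²)^(m+1). Everything
else is bounded below on (a, s) by its value at s. -/
lemma tendsto_robinFlux_nhdsGT (ha0 : 0 < a) (ha1 : a < 1) :
    Tendsto (robinFlux m a) (𝓝[>] a) atTop := by
  set s := (a + 1) / 2
  have hs : s ∈ Set.Ioo a 1 := ⟨by simp only [s]; linarith, by simp only [s]; linarith⟩
  have hs0 := ha0.trans hs.1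
  -- The index is shifted by one to drop the singular first term.
  set C := (∑' k : ℕ, a ^ (m * (k + 1 + 1)) * diagFlux m (a ^ (2 * (k + 1 + 1))) s) -
    2 * s ^ 2 * ((1 - s ^ 2) ^ (m + 1))⁻¹ +
    if m = 0 then 2 * (Real.log s / Real.log a) else 0
  have hev : Set.Ioo a s ∈ 𝓝[>] a := Ioo_mem_nhdsGT hs.1
  have hm1 : Tendsto (fun r : ℝ => a ^ m * diagFlux m (a ^ 2) r) (𝓝[>] a) atTop := by
    refine Tendsto.const_mul_atTop (by positivity) ?_
    have ha2 : a ^ 2 < 1 := pow_lt_one₀ ha0.le ha1 (by norm_num)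
    have e1 : ((1 - a ^ 2) * a) ^ m ≠ 0 :=
      pow_ne_zero _ (mul_ne_zero (by linarith) ha0.ne')
    have e2 : (1 - a ^ 2 * a ^ 2) ^ (m + 1) ≠ 0 := pow_ne_zero _ (by nlinarith)
    have c1 : ContinuousAt (fun r : ℝ => -2 * (((1 - a ^ 2) * r) ^ m)⁻¹) a := by
      fun_prop (disch := assumption)
    have c2 : ContinuousAt (fun r : ℝ => 2 * a ^ 2 * r ^ 2 * ((1 - a ^ 2 * r ^ 2) ^ (m + 1))⁻¹) a := by
      fun_prop (disch := assumption)
    have c3 : Tendsto (fun r : ℝ => 2 * r ^ 2) (𝓝[>] a) (𝓝 (2 * a ^ 2)) := by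
      have h : Continuous fun r : ℝ => 2 * r ^ 2 := by fun_prop
      exact (h.tendsto a).mono_left nhdsWithin_le_nhds
    have h1 : Tendsto (fun r : ℝ => r ^ 2 - a ^ 2) (𝓝[>] a) (𝓝[>] 0) := by
      refine tendsto_nhdsWithin_iff.2 ⟨?_, ?_⟩
      · have h : Continuous fun r : ℝ => r ^ 2 - a ^ 2 := by fun_prop
        have h' := h.tendsto a
        rw [sub_self] at h'
        exact h'.mono_left nhdsWithin_le_nhds
      · filter_upwards [self_mem_nhdsWithin] with r hr
        exact sub_pos.2 (pow_lt_pow_left₀ hr ha0.le (by norm_num))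
    have h2 := c3.pos_mul_atTop (by positivity) (tendsto_inv_pow_atTop h1 (N := m + 1) (by omega))
    have h3 := (c1.tendsto.mono_left (nhdsWithin_le_nhds (s := Set.Ioi a))).add_atTop h2
    have h4 := h3.atTop_add (c2.tendsto.neg.mono_left (nhdsWithin_le_nhds (s := Set.Ioi a)))
    refine h4.congr fun r => ?_
    rw [diagFlux]
    ring
  refine tendsto_atTop_mono' _ ?_ (hm1.atTop_add (tendsto_const_nhds (x := C)))
  filter_upwards [hev] with r hr
  have hr' : r ∈ Set.Ioo a 1 := ⟨hr.1, hr.2.trans hs.2⟩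
  have hr0 := ha0.trans hr.1
  have h1 := ((summable_nat_add_iff 1).2 (summable_flux (m := m) ha0 ha1 hs)).tsum_le_tsum
    (fun k => antitoneOn_diagFlux ha0 ha1 (k + 1) hr' hs hr.2.le)
    ((summable_nat_add_iff 1).2 (summable_flux (m := m) ha0 ha1 hr'))
  have h2 := log_term_antitone (m := m) ha0 ha1 hr0 hr.2.le
  have h3 : 2 * r ^ 2 * ((1 - r ^ 2) ^ (m + 1))⁻¹ ≤ 2 * s ^ 2 * ((1 - s ^ 2) ^ (m + 1))⁻¹ := by
    have : 0 < 1 - s ^ 2 := sub_pos.2 (pow_lt_one₀ hs0.le hs.2 (by norm_num))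
    have : 0 < 1 - r ^ 2 := sub_pos.2 (pow_lt_one₀ hr0.le hr'.2 (by norm_num))
    have := hr.2.le
    gcongr
  have h4 := (summable_flux (m := m) ha0 ha1 hr').tsum_eq_zero_add
  simp only [Nat.zero_add, mul_one] at h4
  simp only [robinFlux, C, h4]
  linarith

end Series

/-! ### From the flux to the critical point. -/

/-- A function on `(a, 1)` whose logarithmic derivative `r R'(r) = D r` strictly decreases from
`+∞` to `-∞`. -/
lemma profile_of_flux {a : ℝ} (ha0 : 0 < a) (ha1 : a < 1) {R D D' : ℝ → ℝ}
    (hR : ∀ r ∈ Set.Ioo a 1, HasDerivAt R (r⁻¹ * D r) r)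
    (hD : ∀ r ∈ Set.Ioo a 1, HasDerivAt D (D' r) r) (hD' : ContinuousOn D' (Set.Ioo a 1))
    (hneg : ∀ r ∈ Set.Ioo a 1, D' r < 0) (hlim : Tendsto D (𝓝[>] a) atTop)
    (hlim' : Tendsto D (𝓝[<] 1) atBot) :
    ContDiffOn ℝ 2 R (Set.Ioo a 1) ∧
      (∃ r₀ ∈ Set.Ioo a 1,
        (∀ r ∈ Set.Ioo a 1, deriv R r = 0 ↔ r = r₀) ∧ deriv (deriv R) r₀ < 0) ∧
      StrictAntiOn (fun r => r * deriv R r) (Set.Ioo a 1) ∧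
      Tendsto (fun r => r * deriv R r) (𝓝[>] a) atTop ∧
      Tendsto (fun r => r * deriv R r) (𝓝[<] 1) atBot := by
  have hpos : ∀ r ∈ Set.Ioo a 1, r ≠ 0 := fun r hr => (ha0.trans hr.1).ne'
  have hdR : ∀ r ∈ Set.Ioo a 1, deriv R r = r⁻¹ * D r := fun r hr => (hR r hr).deriv
  have hmul : ∀ r ∈ Set.Ioo a 1, r * deriv R r = D r := fun r hr => by
    rw [hdR r hr, mul_inv_cancel_left₀ (hpos r hr)]
  have hDanti : StrictAntiOn D (Set.Ioo a 1) := by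
    refine strictAntiOn_of_deriv_neg (convex_Ioo a 1)
      (fun r hr => (hD r hr).continuousAt.continuousWithinAt) fun r hr => ?_
    rw [interior_Ioo] at hr
    rw [(hD r hr).deriv]
    exact hneg r hr
  have hevR : ∀ r ∈ Set.Ioo a 1, deriv R =ᶠ[𝓝 r] fun r => r⁻¹ * D r := fun r hr => by
    filter_upwards [isOpen_Ioo.mem_nhds hr] with s hs using hdR s hs
  have hddR : ∀ r ∈ Set.Ioo a 1,
      HasDerivAt (deriv R) (-(r ^ 2)⁻¹ * D r + r⁻¹ * D' r) r := fun r hr =>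
    (((hasDerivAt_inv (hpos r hr)).mul (hD r hr))).congr_of_eventuallyEq (hevR r hr)
  refine ⟨?_, ?_, ?_, ?_, ?_⟩
  · rw [show (2 : WithTop ℕ∞) = 1 + 1 by norm_num, contDiffOn_succ_iff_deriv_of_isOpen isOpen_Ioo]
    refine ⟨fun r hr => (hR r hr).differentiableAt.differentiableWithinAt, by simp, ?_⟩
    rw [show (1 : WithTop ℕ∞) = 0 + 1 by norm_num, contDiffOn_succ_iff_deriv_of_isOpen isOpen_Ioo]
    refine ⟨fun r hr => (hddR r hr).differentiableAt.differentiableWithinAt, by simp, ?_⟩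
    rw [contDiffOn_zero]
    have hc : ContinuousOn (fun r => -(r ^ 2)⁻¹ * D r + r⁻¹ * D' r) (Set.Ioo a 1) := by
      have hDc : ContinuousOn D (Set.Ioo a 1) :=
        fun r hr => (hD r hr).continuousAt.continuousWithinAt
      have hi : ContinuousOn (fun r : ℝ => r⁻¹) (Set.Ioo a 1) := continuousOn_id.inv₀ hpos
      have hi2 : ContinuousOn (fun r : ℝ => (r ^ 2)⁻¹) (Set.Ioo a 1) :=
        (continuousOn_id.pow 2).inv₀ fun r hr => pow_ne_zero 2 (hpos r hr)
      exact (hi2.neg.mul hDc).add (hi.mul hD')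
    exact hc.congr fun r hr => (hddR r hr).deriv
  · obtain ⟨r₁, h₁, hr₁⟩ := ((hlim.eventually_ge_atTop 0).and (Ioo_mem_nhdsGT ha1)).exists
    obtain ⟨r₂, h₂, hr₂⟩ := ((hlim'.eventually_le_atBot 0).and (Ioo_mem_nhdsLT ha1)).exists
    have hz : (0 : ℝ) ∈ D '' Set.Ioo a 1 :=
      isPreconnected_Ioo.intermediate_value hr₂ hr₁
        (fun r hr => (hD r hr).continuousAt.continuousWithinAt) ⟨h₂, h₁⟩
    obtain ⟨r₀, hr₀, hD0⟩ := hz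
    refine ⟨r₀, hr₀, fun r hr => ?_, ?_⟩
    · rw [hdR r hr, mul_eq_zero, or_iff_right (inv_ne_zero (hpos r hr)), ← hD0]
      exact ⟨fun h => hDanti.injOn hr hr₀ h, fun h => by rw [h]⟩
    -- Since D vanishes at r₀, the second derivative reduces to D'(r₀)/r₀.
    · rw [(hddR r₀ hr₀).deriv, hD0, mul_zero, zero_add]
      exact mul_neg_of_pos_of_neg (inv_pos.2 (ha0.trans hr₀.1)) (hneg r₀ hr₀)
  · exact hDanti.congr fun r hr => (hmul r hr).symm
  · refine hlim.congr' ?_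
    filter_upwards [Ioo_mem_nhdsGT ha1] with r hr using (hmul r hr).symm
  · refine hlim'.congr' ?_
    filter_upwards [Ioo_mem_nhdsLT ha1] with r hr using (hmul r hr).symm

/-- The Green function and the Robin function of the annulus exist (they are not default values),
and the Robin function is radial, `R_A(x) = R(|x|)`, with a profile `R` which has exactly one
critical point `r₀` in `(a, 1)`; moreover `R''(r₀) < 0`, and `r R'(r)` is strictly decreasing
from `+∞` to `-∞`. -/
theorem theorem1p3 (n : ℕ) (hn : 2 ≤ n) (a : ℝ) (ha0 : 0 < a) (ha1 : a < 1) :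
    IsGreenFunction (annulus n a) (greenFunction (annulus n a)) ∧
    (∀ y ∈ annulus n a, Tendsto (fun x => regularPart (annulus n a) x y) (𝓝[≠] y)
      (𝓝 (robinFunction (annulus n a) y))) ∧
    ∃ R : ℝ → ℝ,
      (∀ x ∈ annulus n a, robinFunction (annulus n a) x = R ‖x‖) ∧
      ContDiffOn ℝ 2 R (Set.Ioo a 1) ∧
      (∃ r₀ ∈ Set.Ioo a 1,
        (∀ r ∈ Set.Ioo a 1, deriv R r = 0 ↔ r = r₀) ∧ deriv (deriv R) r₀ < 0) ∧
      StrictAntiOn (fun r => r * deriv R r) (Set.Ioo a 1) ∧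
      Tendsto (fun r => r * deriv R r) (𝓝[>] a) atTop ∧
      Tendsto (fun r => r * deriv R r) (𝓝[<] 1) atBot := by
  refine ⟨isGreenFunction_greenFunction hn ha0 ha1, fun y hy => ?_, robinProfile n a,
    fun x hx => ?_, ?_⟩
  · rw [robinFunction_annulus hn ha0 ha1 hy]
    exact tendsto_regularPart hn ha0 ha1 hy
  · rw [robinFunction_annulus hn ha0 ha1 hx, annulusRegular_self ha0 ha1 hx]
  · obtain ⟨m, rfl⟩ : ∃ m, n = m + 2 := ⟨n - 2, by omega⟩
    have hω : 0 < (sphereArea (m + 2))⁻¹ := inv_pos.2 (sphereArea_pos hn)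
    refine profile_of_flux ha0 ha1 (D := fun r => (sphereArea (m + 2))⁻¹ * robinFlux m a r)
      (D' := fun r => (sphereArea (m + 2))⁻¹ * robinFluxDeriv m a r) (fun r hr => ?_)
      (fun r hr => (hasDerivAt_robinFlux ha0 ha1 hr).const_mul _)
      (continuousOn_const.mul (continuousOn_robinFluxDeriv ha0 ha1))
      (fun r hr => mul_neg_of_pos_of_neg hω (robinFluxDeriv_neg ha0 ha1 hr))
      ((tendsto_robinFlux_nhdsGT ha0 ha1).const_mul_atTop hω)
      ((tendsto_robinFlux_nhdsLT_one ha0 ha1).const_mul_atBot hω)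
    refine (hasDerivAt_robinProfile ha0 ha1 hr).congr_deriv ?_
    rw [mul_inv]
    ring
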